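/- Let $X$ be a metric space with Borel $\sigma$-algebra and let $\sigma$ be a finite diffuse Borel measure on $X$ (that is, $\sigma(\{x\})=0$ for all $x$). Let $\Omega$ be the space of configurations on $X$, i.e. of Radon measures $\omega=\sum_i\delta_{x_i}$ with at most countably many, pairwise distinct points $x_i$ (identified with the sets $\{x_1,x_2,\dots\}$), with the $\sigma$-algebra generated by the maps $\omega\mapsto\omega(B)$, $B$ Borel, and let $\pi$ be the Poisson measure with intensity $\sigma$ on $\Omega$, with expectation $E$. For $F:\Omega\to\mathbb R$ put $D_xF(\omega)=F(\omega)-F(\omega+\delta_x)$ if $x\notin\omega$ and $D_xF(\omega)=F(\omega)-F(\omega-\delta_x)$ if $x\in\omega$, and let $D_x^+F=\max(0,D_xF)$, $D_x^-F=-\min(0,D_xF)$. Write $|\cdot|_\infty$ for the (random) norm of $L^\infty(X,\frac{\sigma+\omega}{2})$ in the variable $x$. Define $$h_\infty^\pm=\inf_{0<\pi(A)<1/2}\frac{E[\,|D^\pm 1_A|_\infty]}{\pi(A)},\qquad k_\infty^\pm=\inf_{F}\frac{E[\,|D^\pm F|_\infty]}{E[(F-m(F))^+]},\qquad \lambda_\infty=\inf_{F}\frac{E[\,|DF|_\infty^2]}{\mathrm{Var}\,F},$$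 where $A$ runs over measurable sets; in $k_\infty^\pm$, $F$ runs over the measurable functions with $0<E[(F-m(F))^+]<\infty$, $m(F)$ being the largest median of $F$; and in $\lambda_\infty$, $F$ runs over the measurable square-integrable functions that are not almost surely constant. (Infima are taken in $[0,\infty]$; if $\sigma=0$, they are over empty families, and $\inf\emptyset=\infty$, $1/0=\infty$.) Then $$k^+_\infty=h^+_\infty\le 2\sqrt{\lambda_\infty}=\frac{2}{\sqrt{\sigma(X)}}\qquad\text{and}\qquad k^-_\infty=h^-_\infty\le\frac{2}{\sigma(X)}\Bigl(1+\sqrt{2\sigma(X)}\Bigr).$$ -/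

import Mathlib

open MeasureTheory
open scoped ENNReal Nat

noncomputable section

namespace PoissonSpace

/-- The configuration space over `X`: at most countable sets of points with finitely many points in
each compact set. A configuration `ω = {x₁, x₂, …}` is identified with the Radon measure
`∑ᵢ δ_{xᵢ}`, the points `xᵢ` being distinct. -/
def Configuration (X : Type*) [TopologicalSpace X] : Type _ :=
  {s : Set X // s.Countable ∧ ∀ K : Set X, IsCompact K → (s ∩ K).Finite}

namespace Configuration

variable {X : Type*} [TopologicalSpace X]

/-- The number `ω(B)` of points of the configuration `ω` in the set `B`. -/
def count (ω : Configuration X) (B : Set X) : ℕ∞ := (ω.1 ∩ B).encard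

/-- The configuration `ω + δ_x` (of interest for `x ∉ ω`). -/
def add (ω : Configuration X) (x : X) : Configuration X :=
  ⟨insert x ω.1, ω.2.1.insert x, fun K hK =>
    ((ω.2.2 K hK).insert x).subset (by
      rintro y ⟨hy | hy, hyK⟩
      · exact Or.inl hy
      · exact Or.inr ⟨hy, hyK⟩)⟩

/-- The configuration `ω - δ_x` (of interest for `x ∈ ω`). -/
def remove (ω : Configuration X) (x : X) : Configuration X :=
  ⟨ω.1 \ {x}, ω.2.1.mono Set.sdiff_subset, fun K hK =>
    (ω.2.2 K hK).subset (Set.inter_subset_inter_left K Set.sdiff_subset)⟩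

/-- The configuration as a measure on `X`: the sum of the Dirac masses at its points. -/
def toMeasure [MeasurableSpace X] (ω : Configuration X) : Measure X :=
  Measure.sum fun x : ω.1 => Measure.dirac (x : X)

/-- The `σ`-algebra generated by the maps `ω ↦ ω(B)`, `B` measurable. -/
instance [MeasurableSpace X] : MeasurableSpace (Configuration X) :=
  ⨆ (B : Set X) (_ : MeasurableSet B), MeasurableSpace.comap (fun ω => ω.count B) ⊤

end Configuration

variable {X : Type*} [TopologicalSpace X] [MeasurableSpace X]

/-- `π` is the Poisson measure with intensity `σ`: the numbers of points in disjoint measurable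
sets `A₁, …, Aₙ` are independent Poisson variables with parameters `σ(A₁), …, σ(Aₙ)`. -/
def IsPoissonMeasure (σ : Measure X) (π : Measure (Configuration X)) : Prop :=
  ∀ (n : ℕ) (A : Fin n → Set X) (k : Fin n → ℕ), (∀ i, MeasurableSet (A i)) →
    (Pairwise fun i j => Disjoint (A i) (A j)) →
    π {ω | ∀ i, ω.count (A i) = (k i : ℕ∞)} =
      ENNReal.ofReal (∏ i, σ.real (A i) ^ k i / (k i)! * Real.exp (-σ.real (A i)))

open Classical in
/-- The finite difference gradient `D_x F(ω)`. -/
def grad (F : Configuration X → ℝ) (ω : Configuration X) (x : X) : ℝ :=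
  if x ∈ ω.1 then F ω - F (ω.remove x) else F ω - F (ω.add x)

/-- `D_x⁺ F(ω) = max (0, D_x F(ω))`. -/
def gradPos (F : Configuration X → ℝ) (ω : Configuration X) (x : X) : ℝ :=
  max 0 (grad F ω x)

/-- `D_x⁻ F(ω) = - min (0, D_x F(ω))`. -/
def gradNeg (F : Configuration X → ℝ) (ω : Configuration X) (x : X) : ℝ :=
  -min 0 (grad F ω x)

/-- The norm of `u : X → ℝ` in `L^p((σ + ω)/2)`. -/
def symNorm (σ : Measure X) (p : ℝ≥0∞) (ω : Configuration X) (u : X → ℝ) : ℝ≥0∞ :=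
  eLpNorm u p ((2⁻¹ : ℝ≥0∞) • (σ + ω.toMeasure))

/-- `h_p⁺`, the infimum over measurable `A` with `0 < π(A) < 1/2` of `E[|D⁺1_A|_p] / π(A)`. -/
def hPos (σ : Measure X) (π : Measure (Configuration X)) (p : ℝ≥0∞) : ℝ≥0∞ :=
  ⨅ (A : Set (Configuration X)) (_ : MeasurableSet A) (_ : 0 < π A) (_ : π A < 2⁻¹),
    (∫⁻ ω, symNorm σ p ω (gradPos (A.indicator fun _ => 1) ω) ∂π) / π A

/-- `h_p⁻`, the infimum over measurable `A` with `0 < π(A) < 1/2` of `E[|D⁻1_A|_p] / π(A)`. -/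
def hNeg (σ : Measure X) (π : Measure (Configuration X)) (p : ℝ≥0∞) : ℝ≥0∞ :=
  ⨅ (A : Set (Configuration X)) (_ : MeasurableSet A) (_ : 0 < π A) (_ : π A < 2⁻¹),
    (∫⁻ ω, symNorm σ p ω (gradNeg (A.indicator fun _ => 1) ω) ∂π) / π A

/-- `m` is a median of `F`. -/
def IsMedian (π : Measure (Configuration X)) (F : Configuration X → ℝ) (m : ℝ) : Prop :=
  2⁻¹ ≤ π {ω | F ω ≤ m} ∧ 2⁻¹ ≤ π {ω | m ≤ F ω}

/-- The median `m(F)`. Medians form a nonempty compact interval; its right end is taken. -/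
def median (π : Measure (Configuration X)) (F : Configuration X → ℝ) : ℝ :=
  sSup {m | IsMedian π F m}

/-- The mean excess `E[(F - m(F))⁺]` of `F` over its median. -/
def excess (π : Measure (Configuration X)) (F : Configuration X → ℝ) : ℝ≥0∞ :=
  ∫⁻ ω, ENNReal.ofReal (max (F ω - median π F) 0) ∂π

/-- `k_p⁺`, the functional version of `h_p⁺`: the infimum of `E[|D⁺F|_p] / E[(F - m(F))⁺]` over
all measurable `F` for which the denominator is neither zero nor infinite. -/
def kPos (σ : Measure X) (π : Measure (Configuration X)) (p : ℝ≥0∞) : ℝ≥0∞ :=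
  ⨅ (F : Configuration X → ℝ) (_ : Measurable F) (_ : excess π F ≠ 0) (_ : excess π F ≠ ∞),
    (∫⁻ ω, symNorm σ p ω (gradPos F ω) ∂π) / excess π F

/-- `k_p⁻`, the functional version of `h_p⁻`: the infimum of `E[|D⁻F|_p] / E[(F - m(F))⁺]` over
all measurable `F` for which the denominator is neither zero nor infinite. -/
def kNeg (σ : Measure X) (π : Measure (Configuration X)) (p : ℝ≥0∞) : ℝ≥0∞ :=
  ⨅ (F : Configuration X → ℝ) (_ : Measurable F) (_ : excess π F ≠ 0) (_ : excess π F ≠ ∞),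
    (∫⁻ ω, symNorm σ p ω (gradNeg F ω) ∂π) / excess π F

/-- The Poincaré constant `λ_p`: the infimum of `E[|DF|_p²] / Var F` over all measurable square
integrable `F` which are not almost surely constant. -/
def poincareConst (σ : Measure X) (π : Measure (Configuration X)) (p : ℝ≥0∞) : ℝ≥0∞ :=
  ⨅ (F : Configuration X → ℝ) (_ : Measurable F) (_ : MemLp F 2 π)
    (_ : ProbabilityTheory.evariance F π ≠ 0),
    (∫⁻ ω, symNorm σ p ω (grad F ω) ^ 2 ∂π) / ProbabilityTheory.evariance F π

end PoissonSpace

end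

noncomputable section

namespace PoissonSpace

open ProbabilityTheory PoissonSpace.Configuration
open scoped NNReal

/-! ### The Poisson distribution on the natural numbers -/

/-! Equality of `k` and `h`. Indicators of events of probability below 1/2 have median 0, so `k ≤
h`. Conversely, the norm of D^±1_{F>t} at ω is at most 1, and it vanishes unless t lies in [F(ω) -
|D⁺F|_∞, F(ω)], respectively in [F(ω), F(ω) + |D⁻F|_∞]. Integrating over the levels t above the
median, where π(F > t) < 1/2, gives a co-area inequality (`mul_excess_le`) and hence `h ≤ k`.

Poincaré constant. The number N of points satisfies |DN|_∞ ≤ 1 almost surely and has variance σ(X),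
so λ ≤ 1/σ(X). The converse is Var F ≤ σ(X) E|DF|_∞² (`IsPoissonMeasure.evariance_le`). For a finite
colouring of X the colour counts are independent Poisson variables, and their Poincaré inequality
follows from Efron-Stein and the one-dimensional case. It is applied to the conditional expectation
of F given the counts, whose increments are averages of increments of F by the Mecke formula.
Functions of colour counts are dense in L², which gives the inequality for F itself.

Upper bounds. For functions of N everything reduces to the Poisson law of parameter r = σ(X). The
test functions are the squared distances to m on {n ≥ m} and to m - 1 on {n < m}, for a median-like
integer m. Let d₁ and d₂ be the total first and second moments of these distances. The increments of
k² give h⁻d₂ ≤ 2d₁ + 1 and, for every u, h⁺d₂ ≤ (2 - 2u)d₁ + u²d₂. The constants then come out of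
d₁² ≤ d₂ and r ≤ d₂ + d₁ + 1/4; for h⁻ and small r the event {N > m} is used instead. -/

theorem poissonMeasure_singleton_succ (r : ℝ≥0) (n : ℕ) :
    ((n + 1 : ℕ) : ℝ≥0∞) * poissonMeasure r {n + 1} = r * poissonMeasure r {n} := by
  rw [poissonMeasure_singleton, poissonMeasure_singleton, ← ENNReal.ofReal_natCast,
    ← ENNReal.ofReal_coe_nnreal, ← ENNReal.ofReal_mul (by positivity),
    ← ENNReal.ofReal_mul (by positivity)]
  congr 1
  rw [Nat.factorial_succ, pow_succ]
  push_cast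
  field_simp

/-- The one-dimensional Mecke (Chen-Stein) identity; it yields all moments below and,
coordinatewise, the Mecke formula. -/
theorem lintegral_natCast_mul_poissonMeasure (r : ℝ≥0) (g : ℕ → ℝ≥0∞) :
    ∫⁻ n, n * g n ∂poissonMeasure r = r * ∫⁻ n, g (n + 1) ∂poissonMeasure r := by
  rw [lintegral_countable', lintegral_countable', tsum_eq_zero_add' ENNReal.summable,
    ← ENNReal.tsum_mul_left]
  simp only [Nat.cast_zero, zero_mul, zero_add]
  refine tsum_congr fun n => ?_
  rw [mul_right_comm, poissonMeasure_singleton_succ]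
  ring

theorem lintegral_natCast_poissonMeasure (r : ℝ≥0) :
    ∫⁻ n, (n : ℝ≥0∞) ∂poissonMeasure r = r := by
  simpa using lintegral_natCast_mul_poissonMeasure r fun _ => 1

theorem lintegral_natCast_sq_poissonMeasure (r : ℝ≥0) :
    ∫⁻ n, (n : ℝ≥0∞) ^ 2 ∂poissonMeasure r = r * (r + 1) := by
  have h := lintegral_natCast_mul_poissonMeasure r fun n => n
  simp only [← sq, Nat.cast_add, Nat.cast_one] at h
  rw [h, lintegral_add_right _ measurable_const, lintegral_natCast_poissonMeasure]
  simp

/-- By the Chen-Stein identity the integral is r(P(≤k)P(≥k) - P(<k)P(>k)), and this equals r p_k.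
This exact weight is what Cauchy-Schwarz along integer segments needs to become the sharp Poincaré
inequality. -/
theorem lintegral_lintegral_between (r : ℝ≥0) (k : ℕ) :
    ∫⁻ i, ∫⁻ j, (if i ≤ k ∧ k < j then ((j - i : ℕ) : ℝ≥0∞) else 0) ∂poissonMeasure r
      ∂poissonMeasure r = r * poissonMeasure r {k} := by
  set μ := poissonMeasure r
  have hI : ∫⁻ i in Set.Iic k, (i : ℝ≥0∞) ∂μ = r * μ (Set.Iio k) := by
    have h := lintegral_natCast_mul_poissonMeasure r ((Set.Iic k).indicator 1)
    rw [← lintegral_indicator .of_discrete, ← lintegral_indicator_one .of_discrete]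
    convert h using 2
    · ext i; by_cases hi : i ≤ k <;> simp [hi]
    · refine lintegral_congr fun i => ?_
      simp [Set.indicator_apply]
  have hJ : ∫⁻ j in Set.Ioi k, (j : ℝ≥0∞) ∂μ = r * μ (Set.Ici k) := by
    have h := lintegral_natCast_mul_poissonMeasure r ((Set.Ioi k).indicator 1)
    rw [← lintegral_indicator .of_discrete, ← lintegral_indicator_one .of_discrete]
    convert h using 2
    · ext i; by_cases hi : k < i <;> simp [hi]
    · refine lintegral_congr fun i => ?_
      simp [Set.indicator_apply]
  -- The negative term is kept on the left, which avoids subtraction in `ℝ≥0∞`; it is finite and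
  -- cancels at the end.
  have key : (∫⁻ i, ∫⁻ j, (if i ≤ k ∧ k < j then ((j - i : ℕ) : ℝ≥0∞) else 0) ∂μ ∂μ)
      + r * μ (Set.Iio k) * μ (Set.Ioi k) = μ (Set.Iic k) * (r * μ (Set.Ici k)) := by
    rw [← hI, ← hJ, ← lintegral_indicator .of_discrete, ← lintegral_indicator .of_discrete,
      ← lintegral_indicator_one (μ := μ) (s := Set.Ioi k) .of_discrete,
      ← lintegral_indicator_one (μ := μ) (s := Set.Iic k) .of_discrete,
      ← lintegral_mul_const _ .of_discrete, ← lintegral_mul_const _ .of_discrete,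
      ← lintegral_add_left .of_discrete]
    refine lintegral_congr fun i => ?_
    rw [← lintegral_const_mul _ .of_discrete, ← lintegral_const_mul _ .of_discrete,
      ← lintegral_add_left .of_discrete]
    refine lintegral_congr fun j => ?_
    by_cases hi : i ≤ k <;> by_cases hj : k < j <;> simp [hi, hj]
    exact tsub_add_cancel_of_le (by exact_mod_cast hi.trans hj.le)
  have e1 : μ (Set.Iic k) = μ (Set.Iio k) + μ {k} := by
    rw [← measure_union (by simp) .of_discrete]
    congr 1
    ext i; simp [le_iff_lt_or_eq]
  have e2 : μ (Set.Ici k) = μ (Set.Ioi k) + μ {k} := by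
    rw [← measure_union (by simp) .of_discrete]
    congr 1
    ext i; simp [le_iff_lt_or_eq, eq_comm (a := k)]
  have e3 : μ (Set.Iio k) + (μ (Set.Ioi k) + μ {k}) = 1 := by
    rw [← e2, ← measure_union (by rw [Set.disjoint_left]; simp) .of_discrete]
    rw [← measure_univ (μ := μ)]
    congr 1
    ext i; simp
  have hfin : r * μ (Set.Iio k) * μ (Set.Ioi k) ≠ ∞ := by finiteness
  refine (ENNReal.add_left_inj hfin).1 ?_
  rw [key, e1, e2]
  calc (μ (Set.Iio k) + μ {k}) * (r * (μ (Set.Ioi k) + μ {k}))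
      = r * μ {k} * (μ (Set.Iio k) + (μ (Set.Ioi k) + μ {k}))
        + r * μ (Set.Iio k) * μ (Set.Ioi k) := by ring
    _ = _ := by rw [e3, mul_one]

/-- Cauchy-Schwarz along the integer segment from `i` to `j`. -/
theorem ofReal_sq_sub_le_sum (f : ℕ → ℝ) {i j : ℕ} (hij : i ≤ j) :
    ENNReal.ofReal ((f i - f j) ^ 2) ≤ ∑' k, ENNReal.ofReal ((f (k + 1) - f k) ^ 2) *
      (if i ≤ k ∧ k < j then ((j - i : ℕ) : ℝ≥0∞) else 0) := by
  have h1 : f j - f i = ∑ k ∈ Finset.Ico i j, (f (k + 1) - f k) :=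
    (Finset.sum_Ico_sub f hij).symm
  have h2 := sq_sum_le_card_mul_sum_sq (s := Finset.Ico i j) (f := fun k => f (k + 1) - f k)
  rw [← h1, Nat.card_Ico, sub_sq_comm] at h2
  refine (ENNReal.ofReal_le_ofReal h2).trans ?_
  rw [ENNReal.ofReal_mul (by positivity), ENNReal.ofReal_natCast,
    ENNReal.ofReal_sum_of_nonneg fun _ _ => sq_nonneg _, mul_comm, Finset.sum_mul]
  refine le_trans (le_of_eq ?_) (ENNReal.sum_le_tsum (Finset.Ico i j))
  refine Finset.sum_congr rfl fun k hk => ?_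
  rw [if_pos (Finset.mem_Ico.1 hk)]

/-- The Poincaré inequality for the Poisson distribution on `ℕ`. -/
theorem lintegral_sq_sub_poissonMeasure_le (r : ℝ≥0) (f : ℕ → ℝ) :
    ∫⁻ i, ∫⁻ j, ENNReal.ofReal ((f i - f j) ^ 2) ∂poissonMeasure r ∂poissonMeasure r ≤
      2 * (r * ∫⁻ k, ENNReal.ofReal ((f (k + 1) - f k) ^ 2) ∂poissonMeasure r) := by
  set μ := poissonMeasure r
  set w : ℕ → ℕ → ℝ≥0∞ := fun i j => ∑' k, ENNReal.ofReal ((f (k + 1) - f k) ^ 2) *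
      (if i ≤ k ∧ k < j then ((j - i : ℕ) : ℝ≥0∞) else 0) with hw
  have hle : ∀ i j, ENNReal.ofReal ((f i - f j) ^ 2) ≤ w i j + w j i := by
    intro i j
    rcases le_total i j with h | h
    · exact (ofReal_sq_sub_le_sum f h).trans le_self_add
    · rw [sub_sq_comm]
      exact (ofReal_sq_sub_le_sum f h).trans le_add_self
  have hW : ∫⁻ i, ∫⁻ j, w i j ∂μ ∂μ =
      r * ∫⁻ k, ENNReal.ofReal ((f (k + 1) - f k) ^ 2) ∂μ := by
    simp only [hw]
    have : ∀ i, ∫⁻ j, ∑' k, ENNReal.ofReal ((f (k + 1) - f k) ^ 2) *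
        (if i ≤ k ∧ k < j then ((j - i : ℕ) : ℝ≥0∞) else 0) ∂μ =
        ∑' k, ENNReal.ofReal ((f (k + 1) - f k) ^ 2) *
          ∫⁻ j, (if i ≤ k ∧ k < j then ((j - i : ℕ) : ℝ≥0∞) else 0) ∂μ := fun i => by
      rw [lintegral_tsum fun k => Measurable.aemeasurable .of_discrete]
      exact tsum_congr fun k => lintegral_const_mul _ .of_discrete
    simp only [this]
    rw [lintegral_tsum fun k => Measurable.aemeasurable .of_discrete, lintegral_countable',
      ← ENNReal.tsum_mul_left]
    refine tsum_congr fun k => ?_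
    rw [lintegral_const_mul _ .of_discrete, lintegral_lintegral_between]
    ring
  have hW' : ∫⁻ i, ∫⁻ j, w j i ∂μ ∂μ = ∫⁻ i, ∫⁻ j, w i j ∂μ ∂μ :=
    lintegral_lintegral_swap (Measurable.aemeasurable .of_discrete)
  calc _ ≤ ∫⁻ i, ∫⁻ j, (w i j + w j i) ∂μ ∂μ :=
        lintegral_mono fun i => lintegral_mono fun j => hle i j
    _ = (∫⁻ i, ∫⁻ j, w i j ∂μ ∂μ) + ∫⁻ i, ∫⁻ j, w j i ∂μ ∂μ := by
        rw [← lintegral_add_left .of_discrete]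
        exact lintegral_congr fun i => lintegral_add_left .of_discrete _
    _ = _ := by rw [hW', hW, two_mul]

/-! ### Product measures -/

section Product

variable {ι α : Type*} [Fintype ι] [DecidableEq ι] [MeasurableSpace α]
  (μ : ι → Measure α) [∀ i, IsProbabilityMeasure (μ i)]

/-- Resampling one coordinate preserves a product measure. -/
theorem lintegral_pi_update (i : ι) {f : (ι → α) → ℝ≥0∞} (hf : Measurable f) :
    ∫⁻ x, ∫⁻ t, f (Function.update x i t) ∂μ i ∂Measure.pi μ = ∫⁻ x, f x ∂Measure.pi μ := by
  have hm : Measurable (∫⋯∫⁻_{i}, f ∂μ) := hf.lmarginal μ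
  have : (∫⋯∫⁻_{i}, (∫⋯∫⁻_{i}, f ∂μ) ∂μ) = ∫⋯∫⁻_{i}, f ∂μ := by
    ext x
    rw [lmarginal_singleton]
    simp [lmarginal_update_of_mem]
  have h := lintegral_eq_of_lmarginal_eq (μ := μ) {i} hm hf this
  rw [← h]
  exact lintegral_congr fun x => by rw [lmarginal_singleton]

/-- Given a family of pairs, select the second components at the indices in `I`, the first ones
elsewhere. -/
def selectPair (I : Finset ι) (z : ι → α × α) (i : ι) : α := if i ∈ I then (z i).2 else (z i).1

/-- Given a family of pairs, swap the pairs at the indices in `J`. -/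
def swapPair (J : Finset ι) (z : ι → α × α) (i : ι) : α × α := if i ∈ J then (z i).swap else z i

theorem selectPair_swapPair (I J : Finset ι) (z : ι → α × α) :
    selectPair I (swapPair J z) = selectPair (symmDiff I J) z := by
  ext i
  by_cases hI : i ∈ I <;> by_cases hJ : i ∈ J <;>
    simp [selectPair, swapPair, Finset.mem_symmDiff, hI, hJ]

theorem measurable_selectPair (I : Finset ι) : Measurable (selectPair (α := α) I) := by
  refine measurable_pi_lambda _ fun i => ?_
  unfold selectPair
  split_ifs <;> fun_prop

theorem measurePreserving_swapPair (J : Finset ι) :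
    MeasurePreserving (swapPair J) (Measure.pi fun i => (μ i).prod (μ i))
      (Measure.pi fun i => (μ i).prod (μ i)) := by
  have := measurePreserving_pi (fun i => (μ i).prod (μ i)) (fun i => (μ i).prod (μ i))
    (f := fun i p => if i ∈ J then p.swap else p) fun i => by
      by_cases h : i ∈ J
      · simpa [h] using Measure.measurePreserving_swap
      · simp only [h, if_false]
        exact MeasurePreserving.id _
  exact this

variable {μ} in
-- Swapping the pairs in `J` preserves the law, so the mean square difference of two selections
-- depends only on the set of indices where they differ.
theorem lintegral_selectPair (f : (ι → α) → ℝ) (hf : Measurable f) (I J : Finset ι) :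
    ∫⁻ z, ENNReal.ofReal ((f (selectPair J z) - f (selectPair (symmDiff I J) z)) ^ 2)
        ∂Measure.pi (fun i => (μ i).prod (μ i)) =
      ∫⁻ z, ENNReal.ofReal ((f (selectPair ∅ z) - f (selectPair I z)) ^ 2)
        ∂Measure.pi (fun i => (μ i).prod (μ i)) := by
  have hm := measurable_selectPair (ι := ι) (α := α)
  rw [← (measurePreserving_swapPair μ J).lintegral_comp (f := fun z =>
    ENNReal.ofReal ((f (selectPair ∅ z) - f (selectPair I z)) ^ 2)) (by
      have h1 := hf.comp (hm ∅)
      have h2 := hf.comp (hm I)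
      exact ((h1.sub h2).pow_const 2).ennreal_ofReal)]
  refine lintegral_congr fun z => ?_
  rw [selectPair_swapPair, selectPair_swapPair, ← Finset.bot_eq_empty, bot_symmDiff]

/-- The quadrilateral inequality: the sum of the squared diagonals is at most the sum of the squared
sides, for the values of `f` at the selections `∅`, `{i}`, `insert i I`, `I`. By symmetry, both
diagonals have the same mean square, and so do opposite sides; hence the factor 2 that cancels. -/
theorem lintegral_selectPair_insert_le (f : (ι → α) → ℝ) (hf : Measurable f) (I : Finset ι) {i : ι}
    (hi : i ∉ I) :
    ∫⁻ z, ENNReal.ofReal ((f (selectPair ∅ z) - f (selectPair (insert i I) z)) ^ 2)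
        ∂Measure.pi (fun i => (μ i).prod (μ i)) ≤
      (∫⁻ z, ENNReal.ofReal ((f (selectPair ∅ z) - f (selectPair {i} z)) ^ 2)
        ∂Measure.pi (fun i => (μ i).prod (μ i))) +
      ∫⁻ z, ENNReal.ofReal ((f (selectPair ∅ z) - f (selectPair I z)) ^ 2)
        ∂Measure.pi (fun i => (μ i).prod (μ i)) := by
  have hm := fun I => hf.comp (measurable_selectPair (ι := ι) (α := α) I)
  have hm2 : ∀ I J, Measurable fun z : ι → α × α =>
      ENNReal.ofReal ((f (selectPair I z) - f (selectPair J z)) ^ 2) :=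
    fun I J => (((hm I).sub (hm J)).pow_const 2).ennreal_ofReal
  have s1 : symmDiff (insert i I) I = {i} := by
    ext j; simp only [Finset.mem_symmDiff, Finset.mem_insert, Finset.mem_singleton]; grind
  have s2 : symmDiff (insert i I) {i} = I := by
    ext j; simp only [Finset.mem_symmDiff, Finset.mem_insert, Finset.mem_singleton]; grind
  have s3 : symmDiff I {i} = insert i I := by
    ext j; simp only [Finset.mem_symmDiff, Finset.mem_insert, Finset.mem_singleton]; grind
  have s4 : symmDiff {i} I = insert i I := by rw [symmDiff_comm, s3]
  have e1 := lintegral_selectPair (μ := μ) f hf (insert i I) I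
  have e2 := lintegral_selectPair (μ := μ) f hf I {i}
  have e3 := lintegral_selectPair (μ := μ) f hf {i} I
  rw [s1] at e1
  rw [s3] at e2
  rw [s4] at e3
  have hm3 : Measurable fun z : ι → α × α =>
      ENNReal.ofReal ((f (selectPair ∅ z) - f (selectPair {i} z)) ^ 2) +
      ENNReal.ofReal ((f (selectPair ∅ z) - f (selectPair I z)) ^ 2) := (hm2 _ _).add (hm2 _ _)
  set Q := Measure.pi (fun i => (μ i).prod (μ i))
  have key : (∫⁻ z, ENNReal.ofReal ((f (selectPair ∅ z) - f (selectPair (insert i I) z)) ^ 2) ∂Q) +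
      (∫⁻ z, ENNReal.ofReal ((f (selectPair I z) - f (selectPair {i} z)) ^ 2) ∂Q) ≤
      ((∫⁻ z, ENNReal.ofReal ((f (selectPair ∅ z) - f (selectPair {i} z)) ^ 2) ∂Q) +
      (∫⁻ z, ENNReal.ofReal ((f (selectPair ∅ z) - f (selectPair I z)) ^ 2) ∂Q)) +
      ((∫⁻ z, ENNReal.ofReal ((f (selectPair I z) - f (selectPair (insert i I) z)) ^ 2) ∂Q) +
      (∫⁻ z, ENNReal.ofReal ((f (selectPair {i} z) - f (selectPair (insert i I) z)) ^ 2) ∂Q)) := by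
    rw [← lintegral_add_left (hm2 _ _), ← lintegral_add_left (hm2 _ _),
      ← lintegral_add_left (hm2 _ _), ← lintegral_add_left hm3]
    refine lintegral_mono fun z => ?_
    rw [← ENNReal.ofReal_add (by positivity) (by positivity),
      ← ENNReal.ofReal_add (by positivity) (by positivity),
      ← ENNReal.ofReal_add (by positivity) (by positivity),
      ← ENNReal.ofReal_add (by positivity) (by positivity)]
    refine ENNReal.ofReal_le_ofReal ?_
    nlinarith [sq_nonneg (f (selectPair ∅ z) - f (selectPair {i} z) - f (selectPair I z)
      + f (selectPair (insert i I) z))]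
  rw [e1, e2, e3] at key
  rw [← two_mul, ← two_mul] at key
  exact (ENNReal.mul_le_mul_iff_right (by simp) (by simp)).1 key

/-- The Efron-Stein inequality. -/
theorem lintegral_sq_sub_pi_le (f : (ι → α) → ℝ) (hf : Measurable f) :
    ∫⁻ x, ∫⁻ y, ENNReal.ofReal ((f x - f y) ^ 2) ∂Measure.pi μ ∂Measure.pi μ ≤
      ∑ i, ∫⁻ z, ENNReal.ofReal ((f (fun i => (z i).1) -
          f (Function.update (fun i => (z i).1) i (z i).2)) ^ 2)
        ∂Measure.pi (fun i => (μ i).prod (μ i)) := by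
  set Q := Measure.pi (fun i => (μ i).prod (μ i)) with hQ
  have hsum : ∀ I : Finset ι,
      ∫⁻ z, ENNReal.ofReal ((f (selectPair ∅ z) - f (selectPair I z)) ^ 2) ∂Q ≤
      ∑ i ∈ I, ∫⁻ z, ENNReal.ofReal ((f (selectPair ∅ z) - f (selectPair {i} z)) ^ 2) ∂Q := by
    intro I
    induction I using Finset.induction_on with
    | empty => simp
    | insert i I hi ih =>
      rw [Finset.sum_insert hi]
      exact (lintegral_selectPair_insert_le μ f hf I hi).trans (by gcongr)
  have hmp : MeasurePreserving (MeasurableEquiv.arrowProdEquivProdArrow α α ι) Q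
      ((Measure.pi μ).prod (Measure.pi μ)) :=
    measurePreserving_arrowProdEquivProdArrow α α ι μ μ
  have hm : Measurable fun p : (ι → α) × (ι → α) => ENNReal.ofReal ((f p.1 - f p.2) ^ 2) := by
    fun_prop
  rw [← lintegral_prod (fun p : (ι → α) × (ι → α) => ENNReal.ofReal ((f p.1 - f p.2) ^ 2))
    hm.aemeasurable, ← hmp.lintegral_comp hm]
  refine le_trans (le_of_eq ?_) ((hsum Finset.univ).trans (le_of_eq ?_))
  · refine lintegral_congr fun z => ?_
    congr 4
    ext i
    simp [selectPair]
    rfl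
  · refine Finset.sum_congr rfl fun i _ => lintegral_congr fun z => ?_
    have h1 : selectPair ∅ z = fun i => (z i).1 := by ext j; simp [selectPair]
    have h2 : selectPair {i} z = Function.update (fun i => (z i).1) i (z i).2 := by
      ext j
      by_cases h : j = i
      · subst h; simp [selectPair]
      · simp [selectPair, h]
    rw [h1, h2]

end Product

/-! ### Products of Poisson distributions -/

section PoissonProduct

variable {ι : Type*} [Fintype ι] [DecidableEq ι] (r : ι → ℝ≥0)

theorem lintegral_natCast_mul_pi_poissonMeasure (i : ι) (g : (ι → ℕ) → ℝ≥0∞) :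
    ∫⁻ k, k i * g k ∂Measure.pi (fun i => poissonMeasure (r i)) =
      r i * ∫⁻ k, g (k + Pi.single i 1) ∂Measure.pi (fun i => poissonMeasure (r i)) := by
  refine Eq.trans ?_ (congrArg ((r i : ℝ≥0∞) * ·) (lintegral_pi_update (fun i => poissonMeasure (r i)) i
    (f := fun k => g (k + Pi.single i 1)) .of_discrete))
  rw [← lintegral_pi_update _ i .of_discrete, ← lintegral_const_mul _ .of_discrete]
  refine lintegral_congr fun k => ?_
  simp only [Function.update_self]
  rw [lintegral_natCast_mul_poissonMeasure (r i) fun t => g (Function.update k i t)]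
  congr 1
  refine lintegral_congr fun t => ?_
  congr 1
  ext j
  by_cases h : j = i
  · subst h; simp
  · simp [h]

/-- The Poincaré inequality for products of Poisson distributions. -/
theorem lintegral_sq_sub_pi_poissonMeasure_le (f : (ι → ℕ) → ℝ) :
    ∫⁻ k, ∫⁻ l, ENNReal.ofReal ((f k - f l) ^ 2) ∂Measure.pi (fun i => poissonMeasure (r i))
        ∂Measure.pi (fun i => poissonMeasure (r i)) ≤
      2 * ∑ i, r i * ∫⁻ k, ENNReal.ofReal ((f (k + Pi.single i 1) - f k) ^ 2)
        ∂Measure.pi (fun i => poissonMeasure (r i)) := by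
  set μ := fun i => poissonMeasure (r i) with hμ
  refine (lintegral_sq_sub_pi_le μ f .of_discrete).trans ?_
  rw [Finset.mul_sum]
  refine Finset.sum_le_sum fun i _ => ?_
  set Q := Measure.pi (fun i => (μ i).prod (μ i)) with hQ
  have hfst : MeasurePreserving (fun (z : ι → ℕ × ℕ) i => (z i).1) Q (Measure.pi μ) :=
    measurePreserving_pi (fun i => (μ i).prod (μ i)) μ fun i => measurePreserving_fst
  have hup : ∀ (z : ι → ℕ × ℕ) (p : ℕ × ℕ), (fun j => (Function.update z i p j).1) =
      Function.update (fun j => (z j).1) i p.1 := fun z p => by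
    ext j
    by_cases h : j = i
    · subst h; simp
    · simp [h]
  -- Resampling the i-th pair inside the integral freezes the other coordinates, so that the
  -- one-dimensional inequality applies.
  rw [← lintegral_pi_update _ i .of_discrete]
  calc _ ≤ ∫⁻ z, 2 * (r i * ∫⁻ p : ℕ × ℕ, ENNReal.ofReal
        ((f (Function.update (fun j => (z j).1) i (p.1 + 1)) -
          f (Function.update (fun j => (z j).1) i p.1)) ^ 2) ∂(μ i).prod (μ i)) ∂Q := by
        refine lintegral_mono fun z => ?_
        simp only [hup, Function.update_self, Function.update_idem]
        rw [lintegral_prod _ (Measurable.aemeasurable .of_discrete),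
          lintegral_prod _ (Measurable.aemeasurable .of_discrete)]
        refine (lintegral_sq_sub_poissonMeasure_le (r i)
          fun t => f (Function.update (fun j => (z j).1) i t)).trans ?_
        simp [hμ]
    _ = 2 * (r i * ∫⁻ z, ∫⁻ p : ℕ × ℕ, ENNReal.ofReal
        ((f ((fun j => (Function.update z i p j).1) + Pi.single i 1) -
          f (fun j => (Function.update z i p j).1)) ^ 2) ∂(μ i).prod (μ i) ∂Q) := by
        rw [← lintegral_const_mul _ .of_discrete, ← lintegral_const_mul _ .of_discrete]
        refine lintegral_congr fun z => ?_
        congr 2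
        refine lintegral_congr fun p => ?_
        rw [hup]
        congr 4
        ext j
        by_cases h : j = i
        · subst h; simp
        · simp [h]
    _ = _ := by
        congr 2
        refine (lintegral_pi_update (fun i => (μ i).prod (μ i)) i (f := fun z => ENNReal.ofReal
          ((f ((fun j => (z j).1) + Pi.single i 1) - f (fun j => (z j).1)) ^ 2))
          .of_discrete).trans ?_
        rw [← hfst.lintegral_comp .of_discrete]

end PoissonProduct

/-! ### Measurability on the configuration space -/

namespace Configuration

/-! ### Adding and removing points; counts of colours -/

section Topological

variable {X : Type*} [TopologicalSpace X]

theorem count_add_of_mem {ω : Configuration X} {x : X} (hx : x ∉ ω.1) {B : Set X} (hB : x ∈ B) :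
    (ω.add x).count B = ω.count B + 1 := by
  rw [count, count, add, Set.insert_inter_of_mem hB,
    Set.encard_insert_of_notMem fun h => hx h.1]

theorem count_add_of_notMem (ω : Configuration X) {x : X} {B : Set X} (hB : x ∉ B) :
    (ω.add x).count B = ω.count B := by
  rw [count, count, add, Set.insert_inter_of_notMem hB]

theorem add_of_mem {ω : Configuration X} {x : X} (hx : x ∈ ω.1) : ω.add x = ω :=
  Subtype.ext (Set.insert_eq_of_mem hx)

theorem notMem_remove (ω : Configuration X) (x : X) : x ∉ (ω.remove x).1 := by
  simp [remove]

theorem add_remove {ω : Configuration X} {x : X} (hx : x ∈ ω.1) : (ω.remove x).add x = ω :=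
  Subtype.ext (by simp [remove, add, Set.insert_eq_of_mem hx])

/-- The numbers of points of each colour. -/
def counts {n : ℕ} (c : X → Fin n) (ω : Configuration X) (i : Fin n) : ℕ∞ := ω.count (c ⁻¹' {i})

theorem counts_add {n : ℕ} (c : X → Fin n) {ω : Configuration X} {x : X} (hx : x ∉ ω.1) :
    counts c (ω.add x) = counts c ω + Pi.single (c x) 1 := by
  ext1 i
  by_cases h : i = c x
  · subst h
    simp [counts, count_add_of_mem hx (B := c ⁻¹' {c x}) rfl]
  · simp [counts, h, count_add_of_notMem ω (B := c ⁻¹' {i}) (x := x) fun h' => h h'.symm]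

theorem count_preimage {n : ℕ} (c : X → Fin n) (T : Finset (Fin n)) (ω : Configuration X) :
    ω.count (c ⁻¹' (T : Set (Fin n))) = ∑ i ∈ T, counts c ω i := by
  have h := T.finite_toSet.encard_biUnion (s := fun i => ω.1 ∩ c ⁻¹' {i})
    (fun i _ j _ hij => by
      rw [Function.onFun, Set.disjoint_left]
      rintro x ⟨-, rfl⟩ ⟨-, h⟩
      exact hij h)
  rw [finsum_mem_coe_finset] at h
  rw [count]
  unfold counts count
  rw [← h]
  congr 1
  ext x
  simp

theorem counts_comp {n m : ℕ} (p : Fin m → Fin n) (c : X → Fin m) (ω : Configuration X) :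
    counts (p ∘ c) ω = fun i => ∑ j ∈ Finset.univ.filter (p · = i), counts c ω j := by
  ext1 i
  rw [← count_preimage, counts]
  congr 1
  ext x
  simp

/-- The product colouring. It makes the cylinder events an algebra and lets any measurable set be
taken as a union of colour classes. -/
theorem exists_common_refinement [MeasurableSpace X] {n m : ℕ} {c : X → Fin n} {d : X → Fin m}
    (hc : Measurable c) (hd : Measurable d) :
    ∃ (e : X → Fin (n * m)) (p : Fin (n * m) → Fin n) (q : Fin (n * m) → Fin m),
      Measurable e ∧ c = p ∘ e ∧ d = q ∘ e := by
  refine ⟨fun x => finProdFinEquiv (c x, d x), fun i => (finProdFinEquiv.symm i).1,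
    fun i => (finProdFinEquiv.symm i).2, ?_, ?_, ?_⟩
  · exact (Measurable.of_discrete (f := finProdFinEquiv)).comp (hc.prodMk hd)
  · ext1 x; simp [- finProdFinEquiv_symm_apply]
  · ext1 x; simp [- finProdFinEquiv_symm_apply]

end Topological

/-! ### The algebra of cylinder events -/

section Measurable

variable {X : Type*} [TopologicalSpace X] [MeasurableSpace X]

theorem measurable_count {B : Set X} (hB : MeasurableSet B) :
    Measurable fun ω : Configuration X => ω.count B :=
  Measurable.of_comap_le (le_iSup₂_of_le B hB le_rfl)

theorem measurable_of_count {α : Type*} [MeasurableSpace α] {f : α → Configuration X}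
    (hf : ∀ B, MeasurableSet B → Measurable fun a => (f a).count B) : Measurable f := by
  rw [measurable_iff_comap_le]
  simp only [instMeasurableSpace, MeasurableSpace.comap_iSup, MeasurableSpace.comap_comp]
  exact iSup₂_le fun B hB => (hf B hB).comap_le

theorem measurable_counts {n : ℕ} {c : X → Fin n} (hc : Measurable c) : Measurable (counts c) :=
  measurable_pi_lambda _ fun _ => measurable_count (hc (measurableSet_singleton _))

variable (X) in
/-- The algebra of events that depend on the numbers of points of finitely many colours. -/
def cylinders : Set (Set (Configuration X)) :=
  {A | ∃ (n : ℕ) (c : X → Fin n) (S : Set (Fin n → ℕ∞)), Measurable c ∧ A = counts c ⁻¹' S}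

theorem isSetAlgebra_cylinders : IsSetAlgebra (cylinders X) where
  empty_mem := ⟨1, fun _ => 0, ∅, measurable_const, rfl⟩
  compl_mem := by
    rintro _ ⟨n, c, S, hc, rfl⟩
    exact ⟨n, c, Sᶜ, hc, rfl⟩
  union_mem := by
    rintro _ _ ⟨n, c, S, hc, rfl⟩ ⟨m, d, T, hd, rfl⟩
    obtain ⟨e, p, q, he, rfl, rfl⟩ := exists_common_refinement hc hd
    refine ⟨_, e, {v | (fun i => ∑ j ∈ Finset.univ.filter (p · = i), v j) ∈ S ∨
      (fun i => ∑ j ∈ Finset.univ.filter (q · = i), v j) ∈ T}, he, ?_⟩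
    ext ω
    simp [counts_comp]

open Classical in
theorem generateFrom_cylinders :
    (inferInstance : MeasurableSpace (Configuration X)) =
      MeasurableSpace.generateFrom (cylinders X) := by
  refine le_antisymm (iSup₂_le fun B hB => ?_) (MeasurableSpace.generateFrom_le ?_)
  · rintro _ ⟨S, -, rfl⟩
    refine MeasurableSpace.measurableSet_generateFrom
      ⟨2, fun x => if x ∈ B then 1 else 0, {v | v 1 ∈ S},
        Measurable.ite hB measurable_const measurable_const, ?_⟩
    ext ω
    have : (fun x => if x ∈ B then (1 : Fin 2) else 0) ⁻¹' {1} = B := by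
      ext x; by_cases h : x ∈ B <;> simp [h]
    simp [counts, this]
  · rintro _ ⟨n, c, S, hc, rfl⟩
    exact measurable_counts hc .of_discrete

variable [MeasurableSingletonClass X]

theorem measurable_add (ω : Configuration X) : Measurable ω.add := by
  classical
  refine measurable_of_count fun B hB => ?_
  have : (fun x => (ω.add x).count B) =
      fun x => if x ∈ B \ ω.1 then ω.count B + 1 else ω.count B := by
    ext1 x
    by_cases hx : x ∈ ω.1
    · simp [add_of_mem hx, hx]
    · by_cases hB : x ∈ B
      · simp [hx, hB, count_add_of_mem]
      · simp [hB, count_add_of_notMem]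
  rw [this]
  exact Measurable.ite (hB.diff ω.2.1.measurableSet) measurable_const measurable_const

end Measurable

end Configuration

open PoissonSpace.Configuration

/-! ### The kernel that adds a point -/

section Kernel

variable {X : Type*} [TopologicalSpace X] [MeasurableSpace X] [MeasurableSingletonClass X]
  (σ : Measure X) [IsFiniteMeasure σ] [NullSingletonClass σ]

theorem ae_notMem (ω : Configuration X) : ∀ᵐ x ∂σ, x ∉ ω.1 := ω.2.1.ae_notMem σ

/-- Diffuseness of σ enters here: almost every `x` misses the countable set `ω`, so adding `x`
raises the count of its colour by exactly one. -/
theorem map_add_cylinder (ω : Configuration X) {n : ℕ} {c : X → Fin n} (hc : Measurable c)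
    (S : Set (Fin n → ℕ∞)) :
    (σ.map ω.add) (counts c ⁻¹' S) =
      ∑ i, σ (c ⁻¹' {i}) * (S.indicator 1 (counts c ω + Pi.single i 1)) := by
  rw [Measure.map_apply ω.measurable_add (measurable_counts hc .of_discrete)]
  have h : σ (ω.add ⁻¹' (counts c ⁻¹' S)) =
      (σ.map c) {i | counts c ω + Pi.single i 1 ∈ S} := by
    rw [Measure.map_apply hc .of_discrete]
    refine measure_congr ?_
    filter_upwards [ae_notMem σ ω] with x hx
    refine propext ?_
    change counts c (ω.add x) ∈ S ↔ _
    rw [counts_add c hx]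
    rfl
  rw [h, ← lintegral_indicator_one .of_discrete, lintegral_fintype]
  refine Finset.sum_congr rfl fun i _ => ?_
  rw [Measure.map_apply hc .of_discrete, mul_comm]
  rfl

/-- The kernel that adds a point distributed according to `σ` to a configuration. -/
def addKernel : Kernel (Configuration X) (Configuration X) where
  toFun ω := σ.map ω.add
  measurable' := by
    refine Measurable.measure_of_isPiSystem generateFrom_cylinders
      isSetAlgebra_cylinders.isSetRing.isSetSemiring.isPiSystem ?_ ?_
    · rintro _ ⟨n, c, S, hc, rfl⟩
      simp only [map_add_cylinder σ _ hc S]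
      exact Finset.measurable_sum _ fun i _ => ((Measurable.of_discrete
        (f := S.indicator (1 : (Fin n → ℕ∞) → ℝ≥0∞))).comp
          ((measurable_counts hc).add_const _)).const_mul _
    · simp [Measure.map_apply (measurable_add _)]

instance : IsFiniteKernel (addKernel σ) :=
  ⟨σ Set.univ, measure_lt_top _ _, fun ω => by
    simp [addKernel, Measure.map_apply (measurable_add _)]⟩

end Kernel

/-! ### The law of the counts and the Mecke formula -/

section Law

variable {X : Type*} [TopologicalSpace X] [MeasurableSpace X]
  {σ : Measure X} [IsFiniteMeasure σ] {π : Measure (Configuration X)}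

theorem IsPoissonMeasure.isProbabilityMeasure (hπ : IsPoissonMeasure σ π) :
    IsProbabilityMeasure π :=
  ⟨by simpa using hπ 0 Fin.elim0 Fin.elim0 (by simp) (by intro i; exact i.elim0)⟩

/-- The joint law of the numbers of points of each colour, as natural numbers. -/
def countsLaw (σ : Measure X) {n : ℕ} (c : X → Fin n) : Measure (Fin n → ℕ) :=
  Measure.pi fun i => poissonMeasure (σ (c ⁻¹' {i})).toNNReal

instance {n : ℕ} (c : X → Fin n) : IsProbabilityMeasure (countsLaw σ c) := by
  unfold countsLaw; infer_instance

theorem measurable_natCast_pi {n : ℕ} :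
    Measurable fun (k : Fin n → ℕ) i => (k i : ℕ∞) := .of_discrete

/-- The defining property prescribes the probabilities of finite counts only. These already sum to
one, so between two probability measures an inequality on singletons suffices; points with an
infinite coordinate have mass zero on the Poisson side. -/
theorem IsPoissonMeasure.map_counts (hπ : IsPoissonMeasure σ π) {n : ℕ} {c : X → Fin n}
    (hc : Measurable c) :
    π.map (counts c) = (countsLaw σ c).map fun k i => (k i : ℕ∞) := by
  have := hπ.isProbabilityMeasure
  have : IsProbabilityMeasure (π.map (counts c)) :=
    Measure.isProbabilityMeasure_map (measurable_counts hc).aemeasurable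
  have : IsProbabilityMeasure ((countsLaw σ c).map fun k i => (k i : ℕ∞)) :=
    Measure.isProbabilityMeasure_map measurable_natCast_pi.aemeasurable
  symm
  refine Measure.eq_of_le_of_measure_univ_eq ?_ (by simp)
  refine Measure.le_iff.2 fun s _ => ?_
  rw [← Measure.tsum_indicator_apply_singleton _ s .of_discrete,
    ← Measure.tsum_indicator_apply_singleton _ s .of_discrete]
  refine ENNReal.tsum_le_tsum fun v => Set.indicator_le_indicator ?_
  rw [Measure.map_apply measurable_natCast_pi .of_discrete]
  by_cases hv : ∃ k : Fin n → ℕ, v = fun i => (k i : ℕ∞)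
  · obtain ⟨k, rfl⟩ := hv
    have h1 : (fun (k : Fin n → ℕ) i => (k i : ℕ∞)) ⁻¹' {fun i => (k i : ℕ∞)} = {k} := by
      ext l
      simp [funext_iff]
    have h2 := hπ n (fun i => c ⁻¹' {i}) k (fun i => hc (measurableSet_singleton i))
      (fun i j hij => by
        refine Set.disjoint_left.2 ?_
        rintro x rfl h
        exact hij h)
    rw [h1, Measure.map_apply (measurable_counts hc) .of_discrete]
    have h3 : counts c ⁻¹' {fun i => (k i : ℕ∞)} = 
        {ω | ∀ i, ω.count (c ⁻¹' {i}) = (k i : ℕ∞)} := by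
      ext ω
      simp [funext_iff, counts]
    rw [h3, h2, countsLaw, Measure.pi_singleton, ENNReal.ofReal_prod_of_nonneg
      fun i _ => by positivity]
    refine le_of_eq (Finset.prod_congr rfl fun i _ => ?_)
    rw [poissonMeasure_singleton]
    congr 1
    simp only [Measure.real, ENNReal.coe_toNNReal_eq_toReal]
    ring
  · refine le_of_eq_of_le ?_ zero_le
    refine measure_mono_null (fun k hk => hv ⟨k, ?_⟩) measure_empty
    exact hk.symm

theorem IsPoissonMeasure.lintegral_counts (hπ : IsPoissonMeasure σ π) {n : ℕ} {c : X → Fin n}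
    (hc : Measurable c) (f : (Fin n → ℕ∞) → ℝ≥0∞) :
    ∫⁻ ω, f (counts c ω) ∂π = ∫⁻ k, f (fun i => (k i : ℕ∞)) ∂countsLaw σ c := by
  rw [← lintegral_map .of_discrete (measurable_counts hc), hπ.map_counts hc,
    lintegral_map .of_discrete measurable_natCast_pi]

variable [MeasurableSingletonClass X] [NullSingletonClass σ]

/-- The Mecke formula. -/
theorem IsPoissonMeasure.addKernel_comp (hπ : IsPoissonMeasure σ π) {B : Set X}
    (hB : MeasurableSet B) :
    addKernel (σ.restrict B) ∘ₘ π = π.withDensity fun ω => (ω.count B : ℝ≥0∞) := by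
  classical
  have := hπ.isProbabilityMeasure
  have key : ∀ A ∈ cylinders X, (addKernel (σ.restrict B) ∘ₘ π) A =
      (π.withDensity fun ω => (ω.count B : ℝ≥0∞)) A := by
    rintro _ ⟨n, c₀, S₀, hc₀, rfl⟩
    -- After refinement `B` is a union of colours, so both sides become sums over the colours in
    -- `T`.
    obtain ⟨c, p, q, hc, rfl, hq⟩ := exists_common_refinement hc₀
      (d := fun x => if x ∈ B then (1 : Fin 2) else 0)
      (Measurable.ite hB measurable_const measurable_const)
    obtain ⟨S, hS⟩ : ∃ S, counts (p ∘ c) ⁻¹' S₀ = (counts c ⁻¹' S : Set (Configuration X)) :=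
      ⟨{v | (fun i => ∑ j ∈ Finset.univ.filter (p · = i), v j) ∈ S₀}, by
        ext ω; simp [counts_comp]⟩
    rw [hS]
    have hA : MeasurableSet (counts c ⁻¹' S : Set (Configuration X)) :=
      measurable_counts hc .of_discrete
    set T : Finset (Fin (n * 2)) := Finset.univ.filter (q · = 1)
    have hBT : B = c ⁻¹' (T : Set (Fin (n * 2))) := by
      ext x
      have h1 : (if x ∈ B then (1 : Fin 2) else 0) = q (c x) := congrFun hq x
      by_cases h : x ∈ B <;> simp [T, h, ← h1]
    have hBi : ∀ i, σ.restrict B (c ⁻¹' {i}) = if i ∈ T then σ (c ⁻¹' {i}) else 0 := fun i => by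
      rw [Measure.restrict_apply (hc (measurableSet_singleton i)), hBT, ← Set.preimage_inter]
      split_ifs with h
      · rw [Set.inter_eq_left.2 (by simpa using h)]
      · rw [Set.singleton_inter_eq_empty.2 (by simpa using h)]
        simp
    rw [Measure.bind_apply hA (Kernel.aemeasurable _), withDensity_apply _ hA,
      ← lintegral_indicator hA]
    calc ∫⁻ ω, addKernel (σ.restrict B) ω (counts c ⁻¹' S) ∂π
        = ∫⁻ ω, ∑ i ∈ T, σ (c ⁻¹' {i}) * S.indicator 1 (counts c ω + Pi.single i 1) ∂π := by
          refine lintegral_congr fun ω => ?_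
          refine (map_add_cylinder (σ.restrict B) ω hc S).trans ?_
          simp [hBi, ite_mul, Finset.sum_ite_mem]
      _ = ∑ i ∈ T, ∫⁻ k, k i * S.indicator 1 (fun j => (k j : ℕ∞)) ∂countsLaw σ c := by
          refine (hπ.lintegral_counts hc fun v => ∑ i ∈ T, σ (c ⁻¹' {i}) *
            S.indicator 1 (v + Pi.single i 1)).trans ?_
          rw [lintegral_finsetSum _ fun _ _ => .of_discrete]
          refine Finset.sum_congr rfl fun i _ => ?_
          rw [lintegral_const_mul _ .of_discrete, countsLaw,
            lintegral_natCast_mul_pi_poissonMeasure _ i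
              fun k => S.indicator 1 (fun j => (k j : ℕ∞)),
            ENNReal.coe_toNNReal (measure_ne_top _ _)]
          congr 1
          refine lintegral_congr fun k => ?_
          congr 1
          ext1 j
          by_cases h : j = i
          · subst h; simp
          · simp [h]
      _ = ∫⁻ ω, ∑ i ∈ T, (counts c ω i : ℝ≥0∞) * S.indicator 1 (counts c ω) ∂π := by
          rw [hπ.lintegral_counts hc fun v => ∑ i ∈ T, (v i : ℝ≥0∞) * S.indicator 1 v,
            lintegral_finsetSum _ fun _ _ => .of_discrete]
          simp
      _ = _ := by
          refine lintegral_congr fun ω => ?_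
          rw [← Finset.sum_mul, hBT]
          have hsum : ((∑ i ∈ T, counts c ω i : ℕ∞) : ℝ≥0∞) =
              ∑ i ∈ T, (counts c ω i : ℝ≥0∞) := map_sum ENat.toENNRealRingHom _ _
          by_cases h : counts c ω ∈ S
          · simp [h, hsum, count_preimage]
          · simp [h]
  exact ext_of_generate_finite _ generateFrom_cylinders
    isSetAlgebra_cylinders.isSetRing.isSetSemiring.isPiSystem key
    (key _ isSetAlgebra_cylinders.univ_mem)

end Law

/-! ### The Poincaré inequality -/

/-- The difference of two independent copies is centred and has twice the variance. -/
theorem two_mul_evariance_eq {Ω : Type*} {mΩ : MeasurableSpace Ω} {μ : Measure Ω}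
    [IsProbabilityMeasure μ] {Y : Ω → ℝ} (hY : MemLp Y 2 μ) (hm : Measurable Y) :
    2 * evariance Y μ = ∫⁻ x, ∫⁻ y, ENNReal.ofReal ((Y x - Y y) ^ 2) ∂μ ∂μ := by
  have h1 := variance_add_prod hY hY.neg
  have hZ : MemLp (fun p : Ω × Ω => Y p.1 + (-Y) p.2) 2 (μ.prod μ) :=
    (hY.comp_fst μ).add (hY.neg.comp_snd μ)
  have hmean : ∫ p : Ω × Ω, (Y p.1 + (-Y) p.2) ∂μ.prod μ = 0 := by
    rw [integral_add ((hY.comp_fst μ).integrable (by norm_num))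
      ((hY.neg.comp_snd μ).integrable (by norm_num)), integral_fun_fst, integral_fun_snd]
    simp [integral_neg]
  rw [variance_neg] at h1
  rw [← hY.ofReal_variance_eq, show (2 : ℝ≥0∞) = ENNReal.ofReal 2 by simp,
    ← ENNReal.ofReal_mul (by norm_num), two_mul, ← h1, hZ.ofReal_variance_eq, evariance,
    hmean, lintegral_prod _ (by fun_prop)]
  refine lintegral_congr fun x => lintegral_congr fun y => ?_
  rw [Real.enorm_eq_ofReal_abs, ← ENNReal.ofReal_pow (abs_nonneg _), sq_abs]
  simp [sub_eq_add_neg]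

theorem sq_lintegral_le_measure_mul {Ω : Type*} {mΩ : MeasurableSpace Ω} {μ : Measure Ω}
    {u : Ω → ℝ≥0∞} (hu : AEMeasurable u μ) :
    (∫⁻ x, u x ∂μ) ^ 2 ≤ μ Set.univ * ∫⁻ x, u x ^ 2 ∂μ := by
  have h := ENNReal.lintegral_mul_le_Lp_mul_Lq μ (Real.HolderConjugate.two_two) hu
    (aemeasurable_const (b := (1 : ℝ≥0∞)))
  simp only [Pi.mul_apply, mul_one, lintegral_const, ENNReal.rpow_two, one_pow, one_mul] at h
  calc (∫⁻ x, u x ∂μ) ^ 2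
      ≤ ((∫⁻ x, u x ^ 2 ∂μ) ^ (1 / 2 : ℝ) * μ Set.univ ^ (1 / 2 : ℝ)) ^ 2 := by gcongr
    _ = _ := by
      rw [mul_pow, ← ENNReal.rpow_natCast, ← ENNReal.rpow_natCast, ← ENNReal.rpow_mul,
        ← ENNReal.rpow_mul]
      norm_num [mul_comm]

/-- Since `G` is its own conditional expectation, the left side involves only `F - G`, and
conditional expectation contracts L². The factor 2 is the triangle inequality; only smallness
matters later. -/
theorem eLpNorm_sub_condExp_le {Ω : Type*} {m mΩ : MeasurableSpace Ω} {μ : Measure Ω}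
    [IsFiniteMeasure μ] (hm : m ≤ mΩ) {F G : Ω → ℝ} (hF : MemLp F 2 μ) (hG : MemLp G 2 μ)
    (hGm : StronglyMeasurable[m] G) :
    eLpNorm (F - μ[F | m]) 2 μ ≤ 2 * eLpNorm (F - G) 2 μ := by
  have hGc : μ[G | m] = G := condExp_of_stronglyMeasurable hm hGm (hG.integrable (by norm_num))
  have e1 : F - μ[F | m] =ᵐ[μ] (F - G) - μ[F - G | m] := by
    filter_upwards [condExp_sub (hF.integrable (by norm_num)) (hG.integrable (by norm_num)) m]
      with ω hω
    simp only [Pi.sub_apply, hω, hGc]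
    ring
  rw [eLpNorm_congr_ae e1, two_mul]
  refine (eLpNorm_sub_le (hF.sub hG).aestronglyMeasurable
    integrable_condExp.aestronglyMeasurable (by norm_num)).trans ?_
  gcongr
  exact eLpNorm_condExp_le_eLpNorm _ (by norm_num)

/-! ### Increments of conditional expectations given the counts -/

section

variable {X : Type*} [TopologicalSpace X] [MeasurableSpace X] [MeasurableSingletonClass X]
  {σ : Measure X} [IsFiniteMeasure σ] [NullSingletonClass σ] {π : Measure (Configuration X)}

theorem addKernel_apply (σ : Measure X) [IsFiniteMeasure σ] [NullSingletonClass σ]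
    (ω : Configuration X) : addKernel σ ω = σ.map ω.add := rfl

/-- The effect on `F` of adding a point in `B`, averaged with respect to `σ`. -/
def addDrift (σ : Measure X) [IsFiniteMeasure σ] [NullSingletonClass σ] (F : Configuration X → ℝ)
    (B : Set X) (ω : Configuration X) : ℝ :=
  ∫ η, F η ∂addKernel (σ.restrict B) ω - σ.real B * F ω

theorem measurable_addDrift {F : Configuration X → ℝ} (hF : Measurable F) (B : Set X) :
    Measurable (addDrift σ F B) :=
  (StronglyMeasurable.integral_kernel (κ := addKernel (σ.restrict B))
    hF.stronglyMeasurable).measurable.sub (hF.const_mul _)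

theorem enorm_addDrift_le {F : Configuration X → ℝ} (hF : Measurable F) (B : Set X)
    {ω : Configuration X} {b : ℝ≥0∞} (hb : ∀ᵐ x ∂σ, ‖F (ω.add x) - F ω‖ₑ ≤ b) :
    ‖addDrift σ F B ω‖ₑ ≤ σ B * b := by
  -- This case is separate because `0 * ∞ = 0`. Afterwards `b = ∞` is trivial, and a finite `b`
  -- makes the increment integrable, so the integral in `addDrift` is not a default value.
  by_cases hB : σ B = 0
  · have : σ.restrict B = 0 := Measure.restrict_eq_zero.2 hB
    simp [addDrift, this, hB, Measure.real, addKernel_apply]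
  by_cases hb' : b = ∞
  · simp [hb', ENNReal.mul_top hB]
  have hbB : ∀ᵐ x ∂σ.restrict B, ‖F (ω.add x) - F ω‖ₑ ≤ b := ae_restrict_of_ae hb
  have hm : Measurable fun x => F (ω.add x) - F ω := (hF.comp ω.measurable_add).sub_const _
  have hint : Integrable (fun x => F (ω.add x) - F ω) (σ.restrict B) := by
    refine ⟨hm.aestronglyMeasurable, ?_⟩
    refine (lintegral_mono_ae hbB).trans_lt ?_
    simp [ENNReal.mul_lt_top, Ne.lt_top hb', measure_lt_top]
  have h : addDrift σ F B ω = ∫ x in B, (F (ω.add x) - F ω) ∂σ := by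
    have hint' : Integrable (fun x => F (ω.add x)) (σ.restrict B) :=
      (hint.add (integrable_const (F ω))).congr (.of_forall fun x => by simp)
    rw [addDrift, addKernel_apply, integral_map ω.measurable_add.aemeasurable
      hF.aestronglyMeasurable, integral_sub hint' (integrable_const _)]
    simp
  rw [h]
  refine (enorm_integral_le_lintegral_enorm _).trans ((lintegral_mono_ae hbB).trans ?_)
  simp [mul_comm]

variable {n : ℕ} {c : X → Fin n}

theorem IsPoissonMeasure.measure_counts_eq (hπ : IsPoissonMeasure σ π) (hc : Measurable c)
    (k : Fin n → ℕ) : π (counts c ⁻¹' {fun i => (k i : ℕ∞)}) = countsLaw σ c {k} := by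
  rw [← Measure.map_apply (measurable_counts hc) .of_discrete, hπ.map_counts hc,
    Measure.map_apply measurable_natCast_pi .of_discrete]
  congr 1
  ext l
  simp [funext_iff]

theorem add_single_eq_iff {v : Fin n → ℕ∞} {k : Fin n → ℕ} {j : Fin n} :
    (v + Pi.single j 1 = fun i => ((k + Pi.single j 1 : Fin n → ℕ) i : ℕ∞)) ↔ v = fun i => (k i : ℕ∞) := by
  have : (fun i => (((k + Pi.single j 1 : Fin n → ℕ) i : ℕ) : ℕ∞)) = (fun i => (k i : ℕ∞)) + Pi.single j 1 := by
    ext1 i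
    by_cases h : i = j
    · subst h; simp
    · simp [h]
  rw [this]
  refine ⟨fun h => ?_, fun h => by rw [h]⟩
  ext1 i
  have hi := congrFun h i
  by_cases hij : i = j
  · subst hij
    simpa using hi
  · simpa [hij] using hi

/-- The Mecke formula on the event that the numbers of points of each colour are given. -/
theorem IsPoissonMeasure.addKernel_comp_restrict (hπ : IsPoissonMeasure σ π) (hc : Measurable c)
    (k : Fin n → ℕ) (j : Fin n) :
    addKernel (σ.restrict (c ⁻¹' {j})) ∘ₘ π.restrict (counts c ⁻¹' {fun i => (k i : ℕ∞)}) =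
      ((k j + 1 : ℕ) : ℝ≥0∞) •
        π.restrict (counts c ⁻¹' {fun i => ((k + Pi.single j 1 : Fin n → ℕ) i : ℕ∞)}) := by
  classical
  have hB : MeasurableSet (c ⁻¹' {j}) := hc (measurableSet_singleton j)
  have hA : ∀ v : Fin n → ℕ∞, MeasurableSet (counts c ⁻¹' {v} : Set (Configuration X)) :=
    fun v => measurable_counts hc .of_discrete
  ext s hs
  rw [Measure.bind_apply hs (Kernel.aemeasurable _), ← lintegral_indicator (hA _),
    Measure.smul_apply, Measure.restrict_apply hs]
  set A' : Set (Configuration X) := counts c ⁻¹' {fun i => ((k + Pi.single j 1 : Fin n → ℕ) i : ℕ∞)} with hA'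
  -- A point of colour `j` is added, so restricting to counts `k` before the addition is the same as
  -- restricting to counts `k + Pi.single j 1` after it.
  have hpt : ∀ ω : Configuration X, (counts c ⁻¹' {fun i => (k i : ℕ∞)}).indicator
      (fun ω => addKernel (σ.restrict (c ⁻¹' {j})) ω s) ω =
        addKernel (σ.restrict (c ⁻¹' {j})) ω (s ∩ A') := by
    intro ω
    rw [addKernel_apply, Measure.map_apply ω.measurable_add (hs.inter (hA _))]
    have hae : ∀ᵐ x ∂σ.restrict (c ⁻¹' {j}), ω.add x ∈ A' ↔ counts c ω = fun i => (k i : ℕ∞) := by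
      filter_upwards [ae_restrict_of_ae (ae_notMem σ ω), ae_restrict_mem hB] with x hx hxj
      rw [hA', Set.mem_preimage, Set.mem_singleton_iff, counts_add c hx,
        show c x = j from hxj, add_single_eq_iff]
    by_cases h : counts c ω = fun i => (k i : ℕ∞)
    · rw [Set.indicator_of_mem (by exact h), addKernel_apply, Measure.map_apply ω.measurable_add hs]
      refine measure_congr ?_
      filter_upwards [hae] with x hx
      exact propext ⟨fun hxs => ⟨hxs, hx.2 h⟩, fun hxs => hxs.1⟩
    · rw [Set.indicator_of_notMem (by exact h)]
      symm
      rw [← nonpos_iff_eq_zero, ← measure_empty (μ := σ.restrict (c ⁻¹' {j}))]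
      refine (measure_congr ?_).le
      filter_upwards [hae] with x hx
      exact propext ⟨fun hxs => h (hx.1 hxs.2), fun hxs => hxs.elim⟩
  rw [lintegral_congr hpt, ← Measure.bind_apply (hs.inter (hA _)) (Kernel.aemeasurable _),
    hπ.addKernel_comp hB, withDensity_apply _ (hs.inter (hA _))]
  -- The Mecke density is constant on `A'`.
  rw [setLIntegral_congr_fun (g := fun _ => ((k j + 1 : ℕ) : ℝ≥0∞)) (hs.inter (hA _))
    fun ω hω => ?_]
  · rw [setLIntegral_const, smul_eq_mul]
  · have := congrFun (show counts c ω = _ from hω.2) j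
    simp only [counts] at this
    simp [this]

variable {F : Configuration X → ℝ}

/-- The restricted Mecke formula turns the mean drift into the integrals of `F` over two
neighbouring count events. With `natCast_mul_measure_counts` it becomes an increment of the
conditional expectation. -/
theorem IsPoissonMeasure.setIntegral_addDrift (hπ : IsPoissonMeasure σ π) (hc : Measurable c)
    (hF : Integrable F π) (k : Fin n → ℕ) (j : Fin n) :
    ∫ ω in counts c ⁻¹' {fun i => (k i : ℕ∞)}, addDrift σ F (c ⁻¹' {j}) ω ∂π =
      (k j + 1 : ℕ) * (∫ ω in counts c ⁻¹' {fun i => ((k + Pi.single j 1 : Fin n → ℕ) i : ℕ∞)}, F ω ∂π) -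
      σ.real (c ⁻¹' {j}) * ∫ ω in counts c ⁻¹' {fun i => (k i : ℕ∞)}, F ω ∂π := by
  have := hπ.isProbabilityMeasure
  set κ := addKernel (σ.restrict (c ⁻¹' {j}))
  set ρ := π.restrict (counts c ⁻¹' {fun i => (k i : ℕ∞)})
  have hcomp : κ ∘ₘ ρ = _ := hπ.addKernel_comp_restrict hc k j
  have hint : Integrable F (κ ∘ₘ ρ) := by
    rw [hcomp]
    exact hF.restrict.smul_measure (ENNReal.natCast_ne_top _)
  have hint' : Integrable F ((κ ∘ₖ Kernel.const Unit ρ) ()) := by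
    rwa [← Measure.comp_eq_comp_const_apply]
  have h1 : Integrable (fun ω => ∫ η, F η ∂κ ω) ρ := by simpa using hint'.integral_comp
  have h2 := Kernel.integral_comp hint'
  rw [← Measure.comp_eq_comp_const_apply, Kernel.const_apply, hcomp, integral_smul_measure] at h2
  unfold addDrift
  rw [integral_sub h1 (hF.restrict.const_mul _), ← h2, integral_const_mul, ENNReal.toReal_natCast,
    smul_eq_mul]

theorem IsPoissonMeasure.natCast_mul_measure_counts (hπ : IsPoissonMeasure σ π)
    (hc : Measurable c) (k : Fin n → ℕ) (j : Fin n) :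
    ((k j + 1 : ℕ) : ℝ≥0∞) * π (counts c ⁻¹' {fun i => ((k + Pi.single j 1 : Fin n → ℕ) i : ℕ∞)}) =
      σ (c ⁻¹' {j}) * π (counts c ⁻¹' {fun i => (k i : ℕ∞)}) := by
  have h := congrArg (· Set.univ) (hπ.addKernel_comp_restrict hc k j)
  simp only [Measure.smul_apply, Measure.restrict_apply_univ, smul_eq_mul] at h
  rw [← h, Measure.bind_apply .univ (Kernel.aemeasurable _)]
  simp [addKernel_apply, Measure.map_apply (measurable_add _)]

variable {f : (Fin n → ℕ∞) → ℝ}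

/-- Here `f` is the conditional expectation of `F` given the counts. Its increment times σ(c⁻¹{j})
is the average of the drift over the event, and the drift is at most σ(c⁻¹{j}) `g`; Cauchy-Schwarz
on the event does the rest. -/
theorem IsPoissonMeasure.sq_sub_mul_measure_le (hπ : IsPoissonMeasure σ π) (hc : Measurable c)
    (hFm : Measurable F) (hF : Integrable F π)
    (hf : ∀ v, ∫ ω in counts c ⁻¹' {v}, F ω ∂π = f v * π.real (counts c ⁻¹' {v}))
    {g : Configuration X → ℝ≥0∞} (hg : ∀ ω, ∀ᵐ x ∂σ, ‖F (ω.add x) - F ω‖ₑ ≤ g ω)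
    (k : Fin n → ℕ) (j : Fin n) (hj : σ (c ⁻¹' {j}) ≠ 0) :
    ENNReal.ofReal ((f (fun i => ((k + Pi.single j 1 : Fin n → ℕ) i : ℕ∞)) - f (fun i => (k i : ℕ∞))) ^ 2) *
      π (counts c ⁻¹' {fun i => (k i : ℕ∞)}) ≤
        ∫⁻ ω in counts c ⁻¹' {fun i => (k i : ℕ∞)}, g ω ^ 2 ∂π := by
  have := hπ.isProbabilityMeasure
  have h1 := hπ.setIntegral_addDrift hc hF k j
  have h2 := hπ.natCast_mul_measure_counts hc k j
  set A : Set (Configuration X) := counts c ⁻¹' {fun i => (k i : ℕ∞)} with hA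
  by_cases hp : π A = 0
  · simp [hp]
  have h2' := congrArg ENNReal.toReal h2
  rw [ENNReal.toReal_mul, ENNReal.toReal_mul, ENNReal.toReal_natCast] at h2'
  rw [hf, hf] at h1
  simp only [← measureReal_def] at h2'
  set δ := f (fun i => ((k + Pi.single j 1 : Fin n → ℕ) i : ℕ∞)) - f (fun i => (k i : ℕ∞)) with hδ
  have h3 : ∫ ω in A, addDrift σ F (c ⁻¹' {j}) ω ∂π = σ.real (c ⁻¹' {j}) * π.real A * δ := by
    rw [h1, hδ]
    linear_combination f (fun i => ((k + Pi.single j 1 : Fin n → ℕ) i : ℕ∞)) * h2'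
  have h4 : σ (c ⁻¹' {j}) * π A * ‖δ‖ₑ ≤ ∫⁻ ω in A, ‖addDrift σ F (c ⁻¹' {j}) ω‖ₑ ∂π := by
    refine le_trans (le_of_eq ?_) (enorm_integral_le_lintegral_enorm _)
    rw [h3, enorm_mul, enorm_mul]
    simp [Measure.real, Real.enorm_eq_ofReal, measure_ne_top]
  have h5 : (σ (c ⁻¹' {j}) * π A * ‖δ‖ₑ) ^ 2 ≤
      (σ (c ⁻¹' {j})) ^ 2 * (π A * ∫⁻ ω in A, g ω ^ 2 ∂π) := by
    calc _ ≤ (∫⁻ ω in A, ‖addDrift σ F (c ⁻¹' {j}) ω‖ₑ ∂π) ^ 2 := by gcongr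
      _ ≤ π A * ∫⁻ ω in A, ‖addDrift σ F (c ⁻¹' {j}) ω‖ₑ ^ 2 ∂π := by
        refine (sq_lintegral_le_measure_mul
          (measurable_addDrift hFm _).enorm.aemeasurable).trans ?_
        rw [Measure.restrict_apply_univ]
      _ ≤ π A * ∫⁻ ω in A, (σ (c ⁻¹' {j})) ^ 2 * g ω ^ 2 ∂π := by
        gcongr with ω
        rw [← mul_pow]
        gcongr
        exact enorm_addDrift_le hFm _ (hg ω)
      _ = _ := by
        rw [lintegral_const_mul' _ _ (by finiteness)]
        ring
  have h6 : (σ (c ⁻¹' {j})) ^ 2 * π A * (‖δ‖ₑ ^ 2 * π A) ≤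
      (σ (c ⁻¹' {j})) ^ 2 * π A * ∫⁻ ω in A, g ω ^ 2 ∂π := by
    calc _ = (σ (c ⁻¹' {j}) * π A * ‖δ‖ₑ) ^ 2 := by ring
      _ ≤ _ := h5
      _ = _ := by ring
  have h7 := (ENNReal.mul_le_mul_iff_right (mul_ne_zero (pow_ne_zero 2 hj) hp)
    (by finiteness)).1 h6
  rwa [Real.enorm_eq_ofReal_abs, ← ENNReal.ofReal_pow (abs_nonneg _), sq_abs] at h7

/-- In the product Poincaré inequality the weights of the colours add up to σ(X), and each colour
contributes at most E[g²] because the events of given counts are disjoint. -/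
theorem IsPoissonMeasure.evariance_comp_counts_le (hπ : IsPoissonMeasure σ π) (hc : Measurable c)
    (hFm : Measurable F) (hF : Integrable F π) (hfL : MemLp (f ∘ counts c) 2 π)
    (hf : ∀ v, ∫ ω in counts c ⁻¹' {v}, F ω ∂π = f v * π.real (counts c ⁻¹' {v}))
    {g : Configuration X → ℝ≥0∞} (hg : ∀ ω, ∀ᵐ x ∂σ, ‖F (ω.add x) - F ω‖ₑ ≤ g ω) :
    evariance (f ∘ counts c) π ≤ σ Set.univ * ∫⁻ ω, g ω ^ 2 ∂π := by
  have := hπ.isProbabilityMeasure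
  have h2 : (2 : ℝ≥0∞) ≠ 0 := by simp
  refine (ENNReal.mul_le_mul_iff_right h2 (by simp)).1 ?_
  rw [two_mul_evariance_eq hfL ((Measurable.of_discrete (f := f)).comp (measurable_counts hc))]
  have h1 : ∫⁻ ω, ∫⁻ η, ENNReal.ofReal (((f ∘ counts c) ω - (f ∘ counts c) η) ^ 2) ∂π ∂π =
      ∫⁻ k, ∫⁻ l, ENNReal.ofReal ((f (fun i => (k i : ℕ∞)) - f (fun i => (l i : ℕ∞))) ^ 2)
        ∂countsLaw σ c ∂countsLaw σ c := by
    rw [← hπ.lintegral_counts hc fun v => ∫⁻ l, ENNReal.ofReal ((f v - f (fun i => (l i : ℕ∞))) ^ 2)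
        ∂countsLaw σ c]
    refine lintegral_congr fun ω => ?_
    exact hπ.lintegral_counts hc fun w => ENNReal.ofReal ((f (counts c ω) - f w) ^ 2)
  rw [h1]
  refine (lintegral_sq_sub_pi_poissonMeasure_le _ fun k => f fun i => (k i : ℕ∞)).trans ?_
  gcongr
  have hsum : σ Set.univ = ∑ j, σ (c ⁻¹' {j}) := by
    rw [sum_measure_preimage_singleton _ fun j _ => hc (measurableSet_singleton j)]
    simp
  rw [hsum, Finset.sum_mul]
  refine Finset.sum_le_sum fun j _ => ?_
  rw [ENNReal.coe_toNNReal (measure_ne_top _ _)]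
  by_cases hj : σ (c ⁻¹' {j}) = 0
  · simp [hj]
  gcongr
  rw [lintegral_countable']
  calc _ ≤ ∑' k : Fin n → ℕ, ∫⁻ ω in counts c ⁻¹' {fun i => (k i : ℕ∞)}, g ω ^ 2 ∂π := by
        refine ENNReal.tsum_le_tsum fun k => ?_
        refine le_trans (le_of_eq ?_) (hπ.sq_sub_mul_measure_le hc hFm hF hf hg k j hj)
        rw [hπ.measure_counts_eq hc]
        rfl
    _ = ∫⁻ ω in ⋃ k : Fin n → ℕ, counts c ⁻¹' {fun i => (k i : ℕ∞)}, g ω ^ 2 ∂π := by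
        rw [lintegral_iUnion (fun k => measurable_counts hc .of_discrete)]
        intro k l hkl
        refine Set.disjoint_left.2 fun ω hk hl => hkl ?_
        have := (show counts c ω = _ from hk).symm.trans (show counts c ω = _ from hl)
        ext i
        simpa using congrFun this i
    _ ≤ _ := setLIntegral_le_lintegral _ _

/-- Cylinders form an algebra generating the σ-algebra, so they approximate every event in measure;
common refinements close the functions of counts under sums. -/
theorem exists_eLpNorm_sub_comp_counts_le [IsFiniteMeasure π] (hF : MemLp F 2 π) {ε : ℝ≥0∞}
    (hε : ε ≠ 0) : ∃ (m : ℕ) (d : X → Fin m) (f : (Fin m → ℕ∞) → ℝ), Measurable d ∧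
      eLpNorm (F - f ∘ counts d) 2 π ≤ ε := by
  have hdense := Measure.MeasureDense.of_generateFrom_isSetAlgebra_finite π
    isSetAlgebra_cylinders (generateFrom_cylinders (X := X))
  suffices h : ∃ G : Configuration X → ℝ, eLpNorm (F - G) 2 π ≤ ε ∧
      ∃ (m : ℕ) (d : X → Fin m), Measurable d ∧ ∃ f : (Fin m → ℕ∞) → ℝ, G = f ∘ counts d by
    obtain ⟨G, hG, m, d, hd, f, rfl⟩ := h
    exact ⟨m, d, f, hd, hG⟩
  refine MemLp.induction_dense (p := 2) (by simp) _ ?_ ?_ ?_ hF hε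
  · intro a s hs _ ε hε
    obtain ⟨η, hη, h⟩ := exists_eLpNorm_indicator_le (μ := π) (p := 2) (by simp) a hε
    obtain ⟨_, ⟨m, d, S, hd, rfl⟩, ht⟩ := hdense.approx s hs (measure_ne_top _ _) η
      (by exact_mod_cast hη)
    refine ⟨_, ?_, m, d, hd, S.indicator fun _ => a, rfl⟩
    rw [show (S.indicator fun _ => a) ∘ counts d =
      (counts d ⁻¹' S : Set (Configuration X)).indicator fun _ => a from rfl,
      eLpNorm_indicator_sub_indicator, symmDiff_comm]
    exact h _ (ht.le.trans (by simp))
  · rintro _ _ ⟨m, d, hd, f, rfl⟩ ⟨m', d', hd', f', rfl⟩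
    obtain ⟨e, p, q, he, rfl, rfl⟩ := exists_common_refinement hd hd'
    refine ⟨_, e, he, fun v => f (fun i => ∑ j ∈ Finset.univ.filter (p · = i), v j) +
      f' (fun i => ∑ j ∈ Finset.univ.filter (q · = i), v j), ?_⟩
    ext ω
    simp [counts_comp]
  · rintro _ ⟨m, d, hd, f, rfl⟩
    exact ((Measurable.of_discrete (f := f)).comp (measurable_counts hd)).aestronglyMeasurable

/-- The Poincaré inequality for functionals of a Poisson process of finite intensity. -/
theorem IsPoissonMeasure.evariance_le (hπ : IsPoissonMeasure σ π) (hFm : Measurable F)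
    (hF : MemLp F 2 π)
    {g : Configuration X → ℝ≥0∞} (hg : ∀ ω, ∀ᵐ x ∂σ, ‖F (ω.add x) - F ω‖ₑ ≤ g ω) :
    evariance F π ≤ σ Set.univ * ∫⁻ ω, g ω ^ 2 ∂π := by
  have := hπ.isProbabilityMeasure
  have hFi := hF.integrable (by norm_num)
  have hnorm : ∀ Y : Configuration X → ℝ, evariance Y π = eLpNorm (fun ω => Y ω - π[Y]) 2 π ^ 2 := by
    intro Y
    rw [evariance, eLpNorm_eq_lintegral_rpow_enorm_toReal (by simp) (by simp), ← ENNReal.rpow_natCast,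
      ← ENNReal.rpow_mul]
    norm_num
  set C := σ Set.univ * ∫⁻ ω, g ω ^ 2 ∂π with hC
  have hle : eLpNorm (fun ω => F ω - π[F]) 2 π ≤ C ^ (1 / 2 : ℝ) := by
    refine ENNReal.le_of_forall_pos_le_add fun ε hε _ => ?_
    obtain ⟨m, d, f₀, hd, h₀⟩ := exists_eLpNorm_sub_comp_counts_le hF (ε := (ε / 2 : ℝ≥0))
      (by simpa using hε.ne')
    have hm := (measurable_counts hd).comap_le
    have hf₀m : Measurable f₀ := .of_discrete
    have hG : MemLp (f₀ ∘ counts d) 2 π := by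
      have h1 : MemLp (F - f₀ ∘ counts d) 2 π :=
        ⟨hFm.aestronglyMeasurable.sub (hf₀m.comp (measurable_counts hd)).aestronglyMeasurable,
          h₀.trans_lt ENNReal.coe_lt_top⟩
      simpa using hF.sub h1
    -- The increments of `f₀` are not controlled. It serves only to show that the conditional
    -- expectation given the same counts is close to `F`.
    have h2 := eLpNorm_sub_condExp_le hm hF hG
      (hf₀m.comp (comap_measurable _)).stronglyMeasurable
    have hcm := hF.condExp (m := .comap (counts d) inferInstance) (by norm_num)
    have hset := fun v : Fin m → ℕ∞ => setIntegral_condExp hm hFi (s := counts d ⁻¹' {v})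
      ⟨{v}, .of_discrete, rfl⟩
    have hmean := integral_condExp hm (f := F) (μ := π)
    obtain ⟨f, -, hf⟩ := (stronglyMeasurable_condExp (μ := π)
      (m := .comap (counts d) inferInstance) (f := F)).measurable.exists_eq_measurable_comp
    rw [hf] at h2 hcm hmean
    have hvar := hπ.evariance_comp_counts_le hd hFm hFi hcm (f := f) (fun v => by
      rw [← hset v, hf]
      refine (setIntegral_congr_fun (s := counts d ⁻¹' {v}) (g := fun _ => f v)
        (measurable_counts hd .of_discrete)
        fun ω (hω : counts d ω = v) => congrArg f hω).trans ?_
      simp [mul_comm]) hg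
    rw [hnorm, hmean] at hvar
    have h1 : eLpNorm (fun ω => (f ∘ counts d) ω - π[F]) 2 π ≤ C ^ (1 / 2 : ℝ) := by
      rw [one_div, ENNReal.le_rpow_inv_iff (by norm_num : (0 : ℝ) < 2), ENNReal.rpow_two]
      exact hvar
    have e2 : (fun ω => F ω - π[F]) =
        (fun ω => (f ∘ counts d) ω - π[F]) + (F - f ∘ counts d) := by
      ext ω; simp
    rw [e2]
    refine (eLpNorm_add_le (hcm.sub (memLp_const _)).aestronglyMeasurable
      (hF.sub hcm).aestronglyMeasurable (by norm_num)).trans ?_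
    refine add_le_add h1 (h2.trans ?_)
    calc _ ≤ 2 * ((ε / 2 : ℝ≥0) : ℝ≥0∞) := by gcongr
      _ = ε := by rw [two_mul, ← ENNReal.coe_add, add_halves]
  rw [hnorm]
  calc _ ≤ (C ^ (1 / 2 : ℝ)) ^ 2 := by gcongr
    _ = C := by rw [← ENNReal.rpow_natCast, ← ENNReal.rpow_mul]; norm_num

end

/-! ### Medians -/

section Median

variable {X : Type*} [TopologicalSpace X] [MeasurableSpace X] {π : Measure (Configuration X)}
  [IsProbabilityMeasure π] {F : Configuration X → ℝ}

theorem half_le_measure_iInter {s : ℕ → Set (Configuration X)} (hs : ∀ n, MeasurableSet (s n))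
    (hanti : Antitone s) (h : ∀ n, 2⁻¹ ≤ π (s n)) : 2⁻¹ ≤ π (⋂ n, s n) :=
  ge_of_tendsto' (tendsto_measure_iInter_atTop (fun n => (hs n).nullMeasurableSet) hanti
    ⟨0, measure_ne_top _ _⟩) h

theorem half_le_measure_compl {s : Set (Configuration X)} (hs : MeasurableSet s)
    (h : π s ≤ 2⁻¹) : 2⁻¹ ≤ π sᶜ := by
  rw [prob_compl_eq_one_sub hs]
  refine ENNReal.le_sub_of_add_le_left (measure_ne_top _ _) ?_
  calc π s + 2⁻¹ ≤ 2⁻¹ + 2⁻¹ := by gcongr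
    _ = 1 := ENNReal.inv_two_add_inv_two

/-- The largest median is determined by the upper tail alone. Continuity from above gives that the
supremum exists and is attained; each larger level has a tail below 1/2, which in the limit gives
the lower-tail condition too. -/
theorem isGreatest_median (hF : Measurable F) :
    IsGreatest {t | 2⁻¹ ≤ π {ω | t ≤ F ω}} (median π F) := by
  set T := {t | 2⁻¹ ≤ π {ω | t ≤ F ω}} with hT
  have hle : ∀ t, MeasurableSet {ω | t ≤ F ω} := fun t => measurableSet_le measurable_const hF
  have hlt : ∀ t, MeasurableSet {ω | F ω < t} := fun t => measurableSet_lt hF measurable_const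
  have hdown : ∀ {t u}, t ∈ T → u ≤ t → u ∈ T := fun ht hu =>
    le_trans ht (measure_mono fun ω hω => hu.trans hω)
  have hcompl : ∀ t, {ω | t ≤ F ω}ᶜ = {ω | F ω < t} := fun t => by ext ω; simp
  have hne : T.Nonempty := by
    by_contra hemp
    have h := half_le_measure_iInter (π := π) (s := fun n : ℕ => {ω | F ω < -(n : ℝ)})
      (fun n => hlt _)
      (fun a b hab ω (hω : F ω < -(b : ℝ)) =>
        lt_of_lt_of_le hω (neg_le_neg (Nat.cast_le.2 hab)))
      (fun n => by
        rw [← hcompl]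
        exact half_le_measure_compl (hle _)
          (not_le.1 fun h' => hemp ⟨_, h'⟩).le)
    have he : (⋂ n : ℕ, {ω | F ω < -(n : ℝ)}) = ∅ := by
      ext ω
      obtain ⟨n, hn⟩ := exists_nat_ge (-F ω)
      simp only [Set.mem_iInter, Set.mem_ofPred_eq, Set.mem_empty_iff_false, iff_false, not_forall]
      exact ⟨n, by linarith⟩
    simp [he] at h
  have hbdd : BddAbove T := by
    by_contra hun
    rw [not_bddAbove_iff] at hun
    have h := half_le_measure_iInter (π := π) (s := fun n : ℕ => {ω | (n : ℝ) ≤ F ω})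
      (fun n => hle _) (fun a b hab ω (hω : (b : ℝ) ≤ F ω) =>
        le_trans (Nat.cast_le.2 hab) hω)
      (fun n => by
        obtain ⟨t, ht, hnt⟩ := hun n
        exact hdown ht hnt.le)
    have he : (⋂ n : ℕ, {ω | (n : ℝ) ≤ F ω}) = ∅ := by
      ext ω
      obtain ⟨n, hn⟩ := exists_nat_gt (F ω)
      simp only [Set.mem_iInter, Set.mem_ofPred_eq, Set.mem_empty_iff_false, iff_false, not_forall]
      exact ⟨n, by linarith⟩
    simp [he] at h
  have hseq : Antitone fun n : ℕ => 1 / ((n : ℝ) + 1) := fun a b hab =>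
    one_div_le_one_div_of_le (by positivity) (by gcongr)
  have hmem : sSup T ∈ T := by
    have h := half_le_measure_iInter (π := π)
      (s := fun n : ℕ => {ω | sSup T - 1 / ((n : ℝ) + 1) ≤ F ω}) (fun n => hle _)
      (fun a b hab ω hω => le_trans (sub_le_sub_left (hseq hab) _) hω)
      (fun n => by
        obtain ⟨t, ht, hnt⟩ := exists_lt_of_lt_csSup hne
          (show sSup T - 1 / ((n : ℝ) + 1) < sSup T from sub_lt_self _ (by positivity))
        exact hdown ht hnt.le)
    refine le_trans h (measure_mono fun ω hω => ?_)
    refine le_of_forall_pos_le_add (α := ℝ) fun ε hε => ?_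
    obtain ⟨n, hn⟩ := exists_nat_one_div_lt hε
    have := Set.mem_iInter.1 hω n
    simp only [Set.mem_ofPred_eq] at this
    linarith
  have hup : 2⁻¹ ≤ π {ω | F ω ≤ sSup T} := by
    have h := half_le_measure_iInter (π := π)
      (s := fun n : ℕ => {ω | F ω < sSup T + 1 / ((n : ℝ) + 1)}) (fun n => hlt _)
      (fun a b hab ω (hω : F ω < sSup T + 1 / ((b : ℝ) + 1)) =>
        hω.trans_le (show sSup T + 1 / ((b : ℝ) + 1) ≤ sSup T + 1 / ((a : ℝ) + 1) by
          have : 1 / ((b : ℝ) + 1) ≤ 1 / ((a : ℝ) + 1) := hseq hab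
          linarith))
      (fun n => by
        rw [← hcompl]
        refine half_le_measure_compl (hle _) (not_le.1 fun h' => ?_).le
        have h1 := le_csSup hbdd (show sSup T + 1 / ((n : ℝ) + 1) ∈ T from h')
        have h2 : 0 < 1 / ((n : ℝ) + 1) := by positivity
        linarith)
    refine le_trans h (measure_mono fun ω hω => ?_)
    refine le_of_forall_pos_le_add (α := ℝ) fun ε hε => ?_
    obtain ⟨n, hn⟩ := exists_nat_one_div_lt hε
    have := Set.mem_iInter.1 hω n
    simp only [Set.mem_ofPred_eq] at this
    linarith
  have hmed : median π F = sSup T := by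
    refine IsGreatest.csSup_eq ⟨⟨hup, hmem⟩, fun m hm => le_csSup hbdd hm.2⟩
  rw [hmed]
  exact ⟨hmem, fun t ht => le_csSup hbdd ht⟩

/-- The strict inequality, needed for `{t < F}` to be admissible in `h`, is the reason for taking
the largest median. -/
theorem measure_le_lt_half (hF : Measurable F) {t : ℝ} (ht : median π F < t) :
    π {ω | t ≤ F ω} < 2⁻¹ :=
  not_le.1 fun h => ht.not_ge ((isGreatest_median hF).2 h)

theorem median_eq_zero (hF : Measurable F) (h0 : ∀ ω, 0 ≤ F ω) (h : π {ω | 0 < F ω} < 2⁻¹) :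
    median π F = 0 := by
  refine (isGreatest_median hF).unique ⟨?_, fun t ht => ?_⟩
  · simp [h0]
  · by_contra! h'
    refine (not_le.2 h) (le_trans ht (measure_mono fun ω hω => ?_))
    exact lt_of_lt_of_le h' hω

theorem excess_eq_lintegral (hF : Measurable F) (h0 : ∀ ω, 0 ≤ F ω)
    (h : π {ω | 0 < F ω} < 2⁻¹) : excess π F = ∫⁻ ω, ENNReal.ofReal (F ω) ∂π := by
  simp [excess, median_eq_zero hF h0 h, h0]

theorem excess_indicator {A : Set (Configuration X)} (hA : MeasurableSet A) (h : π A < 2⁻¹) :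
    excess π (A.indicator fun _ => 1) = π A := by
  rw [excess_eq_lintegral (measurable_const.indicator hA)
    (fun ω => Set.indicator_nonneg (fun _ _ => zero_le_one) ω) (lt_of_le_of_lt (measure_mono
      fun ω hω => ?_) h), ← lintegral_indicator_one hA]
  · refine lintegral_congr fun ω => ?_
    by_cases hω : ω ∈ A <;> simp [hω]
  · by_contra hn
    simp [hn] at hω

end Median

/-! ### The co-area inequality -/

theorem card_filter_mul_le (S : Finset ℕ) {u g ε : ℝ} (hg : 0 ≤ g) (hε : 0 < ε) :
    ((S.filter fun k : ℕ => u ≤ k * ε ∧ k * ε ≤ u + g).card : ℝ) * ε ≤ g + ε := by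
  have h1 : (S.filter fun k : ℕ => u ≤ k * ε ∧ k * ε ≤ u + g).card ≤
      (Finset.Icc ⌈u / ε⌉ ⌊(u + g) / ε⌋).card := by
    refine Finset.card_le_card_of_injOn (fun k : ℕ => (k : ℤ)) (fun k hk => ?_)
      fun a _ b _ hab => Int.ofNat_inj.1 hab
    simp only [Finset.coe_filter, Set.mem_ofPred_eq] at hk
    simp only [Finset.coe_Icc, Set.mem_Icc, Int.ceil_le, Int.le_floor, Int.cast_natCast]
    exact ⟨(div_le_iff₀ hε).2 hk.2.1, (le_div_iff₀ hε).2 hk.2.2⟩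
  rw [Int.card_Icc] at h1
  have h2 : (((⌊(u + g) / ε⌋ + 1 - ⌈u / ε⌉).toNat : ℤ) : ℝ) ≤ g / ε + 1 := by
    rw [Int.toNat_eq_max]
    push_cast
    refine max_le ?_ (by positivity)
    have h3 := Int.floor_le ((u + g) / ε)
    have h4 := Int.le_ceil (u / ε)
    rw [add_div] at h3 ⊢
    linarith
  calc _ ≤ (g / ε + 1) * ε := by
        gcongr
        refine le_trans ?_ h2
        exact_mod_cast h1
    _ = g + ε := by field_simp

/-- A Riemann sum for the layer-cake formula. The levels start at ε, not 0, so that they lie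
strictly above the median when `y = F - m`. -/
theorem ofReal_le_tsum_indicator_add {y ε : ℝ} (hε : 0 < ε) :
    ENNReal.ofReal (max y 0) ≤
      ∑' k : ℕ, ENNReal.ofReal ε * ({z : ℝ | ((k : ℝ) + 1) * ε < z}.indicator 1 y) +
        ENNReal.ofReal ε := by
  rcases le_total y 0 with hy | hy
  · simp [hy]
  rw [max_eq_left hy]
  set n := ⌈y / ε⌉₊ - 1
  have hn : y ≤ (n : ℝ) * ε + ε := by
    have h1 := Nat.le_ceil (y / ε)
    have h2 : ((⌈y / ε⌉₊ : ℕ) : ℝ) ≤ (n : ℝ) + 1 := by exact_mod_cast (by lia : ⌈y / ε⌉₊ ≤ n + 1)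
    have h3 := (div_le_iff₀ hε).1 (h1.trans h2)
    linarith
  calc ENNReal.ofReal y ≤ ENNReal.ofReal ((n : ℝ) * ε + ε) := ENNReal.ofReal_le_ofReal hn
    _ = n * ENNReal.ofReal ε + ENNReal.ofReal ε := by
      rw [ENNReal.ofReal_add (by positivity) hε.le, ENNReal.ofReal_mul (by positivity),
        ENNReal.ofReal_natCast]
    _ ≤ _ := by
      gcongr
      refine le_trans (le_of_eq ?_) (ENNReal.sum_le_tsum (Finset.range n))
      rw [Finset.sum_congr rfl (g := fun _ => ENNReal.ofReal ε) fun k hk => ?_]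
      · simp
      · have hk' : k + 1 < ⌈y / ε⌉₊ := by
          have := Finset.mem_range.1 hk
          lia
        have h1 := Nat.lt_ceil.1 hk'
        rw [lt_div_iff₀ hε] at h1
        push_cast at h1
        simp [h1]

section Coarea

variable {X : Type*} [TopologicalSpace X] [MeasurableSpace X] {π : Measure (Configuration X)}
  [IsProbabilityMeasure π]

/-- An isoperimetric inequality for events implies its functional version, for any gradient norm
`N` that satisfies a co-area bound. -/
theorem mul_excess_le (N : (Configuration X → ℝ) → Configuration X → ℝ≥0∞) {s : ℝ}
    (hs : s = 1 ∨ s = -1) {F : Configuration X → ℝ} (hF : Measurable F)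
    (hN1 : ∀ (A : Set (Configuration X)) ω, N (A.indicator fun _ => 1) ω ≤ 1)
    (hN : ∀ t ω, N ({η | t < F η}.indicator fun _ => 1) ω ≠ 0 →
      0 ≤ s * (t - F ω) ∧ ENNReal.ofReal (s * (t - F ω)) ≤ N F ω)
    {h : ℝ≥0∞} (hh : ∀ A : Set (Configuration X), MeasurableSet A → 0 < π A → π A < 2⁻¹ →
      h * π A ≤ ∫⁻ ω, N (A.indicator fun _ => 1) ω ∂π) :
    h * excess π F ≤ ∫⁻ ω, N F ω ∂π := by
  -- `h` may be infinite, so it is replaced by finite `a < h`.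
  refine ENNReal.mul_le_of_forall_lt fun a ha b hb => ?_
  refine (mul_le_mul_right hb.le a).trans ?_
  lift a to ℝ≥0 using ha.ne_top
  refine ENNReal.le_of_forall_pos_le_add fun δ hδ _ => ?_
  -- The total error is ε from counting levels plus aε from the Riemann sum.
  set ε : ℝ≥0 := δ / (1 + a) with hε
  have hε0 : 0 < ε := by positivity
  have hεδ : (ε : ℝ≥0∞) + a * ε = δ := by
    rw [← ENNReal.coe_mul, ← ENNReal.coe_add, hε]
    congr 1
    field_simp
  set m := median π F with hm
  set E : ℕ → Set (Configuration X) := fun k => {η | m + ((k : ℝ) + 1) * ε < F η} with hE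
  have hEm : ∀ k, MeasurableSet (E k) := fun k => measurableSet_lt measurable_const hF
  have h1 : excess π F ≤ ∑' k, (ε : ℝ≥0∞) * π (E k) + ε := by
    calc excess π F ≤ ∫⁻ ω, (∑' k, (ε : ℝ≥0∞) * ((E k).indicator 1 ω) + ε) ∂π := by
          refine lintegral_mono fun ω => ?_
          refine (ofReal_le_tsum_indicator_add (y := F ω - m) (ε := ε)
            (by exact_mod_cast hε0)).trans (le_of_eq ?_)
          rw [ENNReal.ofReal_coe_nnreal]
          congr 1
          refine tsum_congr fun k => ?_
          congr 1
          simp [hE, Set.indicator_apply, lt_sub_iff_add_lt']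
      _ = _ := by
          rw [lintegral_add_right _ measurable_const, lintegral_tsum fun k =>
            ((measurable_one.indicator (hEm k)).const_mul _).aemeasurable]
          simp only [lintegral_const, measure_univ, mul_one]
          congr 1
          refine tsum_congr fun k => ?_
          rw [lintegral_const_mul _ (measurable_one.indicator (hEm k)),
            lintegral_indicator_one (hEm k)]
  have h2 : ∀ k, a * π (E k) ≤ ∫⁻ ω, N ((E k).indicator fun _ => 1) ω ∂π := by
    intro k
    rcases eq_or_ne (π (E k)) 0 with h0 | h0
    · simp [h0]
    refine (mul_le_mul_left ha.le _).trans (hh _ (hEm k) (pos_iff_ne_zero.2 h0) ?_)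
    have hlt : m < m + ((k : ℝ) + 1) * ε := lt_add_of_pos_right _ (by positivity)
    exact lt_of_le_of_lt (measure_mono fun ω (hω : _ < F ω) => hω.le) (measure_le_lt_half hF hlt)
  have h3 : ∑' k, (ε : ℝ≥0∞) * ∫⁻ ω, N ((E k).indicator fun _ => 1) ω ∂π ≤
      (∫⁻ ω, N F ω ∂π) + ε := by
    rw [ENNReal.tsum_eq_iSup_sum]
    refine iSup_le fun S => ?_
    -- Superadditivity of the lower integral holds without measurability, which is not assumed of
    -- `N`. This is why a Riemann sum replaces an integral over the levels.
    have hsup : ∀ S : Finset ℕ, ∑ k ∈ S, (ε : ℝ≥0∞) * ∫⁻ ω, N ((E k).indicator fun _ => 1) ω ∂π ≤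
        ∫⁻ ω, ∑ k ∈ S, (ε : ℝ≥0∞) * N ((E k).indicator fun _ => 1) ω ∂π := by
      intro S
      induction S using Finset.induction_on with
      | empty => simp
      | insert k S hk ih =>
        simp only [Finset.sum_insert hk]
        refine (add_le_add_right ih _).trans ?_
        rw [← lintegral_const_mul' _ _ ENNReal.coe_ne_top]
        exact le_lintegral_add _ _
    refine (hsup S).trans ?_
    have hc : (∫⁻ ω, N F ω ∂π) + ε = ∫⁻ ω, (N F ω + ε) ∂π := by
      rw [lintegral_add_right _ measurable_const]; simp
    rw [hc]
    refine lintegral_mono fun ω => ?_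
    by_cases hg : N F ω = ∞
    · simp [hg]
    -- The levels seen at `ω` lie in an interval of length `N F ω`: to the right of `F ω` for `s =
    -- 1`, to its left for `s = -1`. The extra `ε` in `u` accounts for the index `k + 1`.
    obtain ⟨u, hu⟩ : ∃ u : ℝ, ∀ k : ℕ, N ((E k).indicator fun _ => 1) ω ≠ 0 →
        u ≤ k * ε ∧ k * ε ≤ u + (N F ω).toReal := by
      have hN' : ∀ k : ℕ, N ((E k).indicator fun _ => 1) ω ≠ 0 →
          0 ≤ s * (m + ((k : ℝ) + 1) * ε - F ω) ∧
            s * (m + ((k : ℝ) + 1) * ε - F ω) ≤ (N F ω).toReal := fun k hk =>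
        ⟨(hN _ ω hk).1, (ENNReal.ofReal_le_iff_le_toReal hg).1 (hN _ ω hk).2⟩
      rcases hs with rfl | rfl
      · refine ⟨F ω - m - ε, fun k hk => ?_⟩
        have := hN' k hk
        constructor <;> linarith [this.1, this.2]
      · refine ⟨F ω - m - ε - (N F ω).toReal, fun k hk => ?_⟩
        have := hN' k hk
        constructor <;> linarith [this.1, this.2]
    calc ∑ k ∈ S, (ε : ℝ≥0∞) * N ((E k).indicator fun _ => 1) ω
        ≤ ∑ k ∈ S, if u ≤ k * ε ∧ k * ε ≤ u + (N F ω).toReal then (ε : ℝ≥0∞) else 0 := by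
          refine Finset.sum_le_sum fun k _ => ?_
          split_ifs with hk
          · exact mul_le_of_le_one_right' (hN1 _ _)
          · rw [not_imp_comm.1 (hu k) hk, mul_zero]
      _ = ENNReal.ofReal (((S.filter fun k : ℕ => u ≤ k * ε ∧
            k * ε ≤ u + (N F ω).toReal).card : ℝ) * ε) := by
          rw [← Finset.sum_filter, Finset.sum_const, nsmul_eq_mul,
            ENNReal.ofReal_mul (by positivity), ENNReal.ofReal_natCast, ENNReal.ofReal_coe_nnreal]
      _ ≤ ENNReal.ofReal ((N F ω).toReal + ε) :=
          ENNReal.ofReal_le_ofReal (card_filter_mul_le S ENNReal.toReal_nonneg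
            (by exact_mod_cast hε0))
      _ = N F ω + ε := by
          rw [ENNReal.ofReal_add ENNReal.toReal_nonneg (by positivity), ENNReal.ofReal_toReal hg,
            ENNReal.ofReal_coe_nnreal]
  calc (a : ℝ≥0∞) * excess π F ≤ a * (∑' k, (ε : ℝ≥0∞) * π (E k) + ε) := by gcongr
    _ = ∑' k, (ε : ℝ≥0∞) * (a * π (E k)) + a * ε := by
        rw [mul_add, ← ENNReal.tsum_mul_left]
        congr 1
        exact tsum_congr fun k => by ring
    _ ≤ ∑' k, (ε : ℝ≥0∞) * (∫⁻ ω, N ((E k).indicator fun _ => 1) ω ∂π) + a * ε := by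
        gcongr with k
        exact h2 k
    _ ≤ (∫⁻ ω, N F ω ∂π) + ε + a * ε := by gcongr
    _ = _ := by rw [add_assoc, hεδ]

end Coarea

/-! ### Isoperimetric constants and their functional versions -/

section Constants

variable {X : Type*} [TopologicalSpace X] [MeasurableSpace X] {σ : Measure X}

theorem symNorm_top_le {ω : Configuration X} {u : X → ℝ} {b : ℝ} (h : ∀ x, |u x| ≤ b) :
    symNorm σ ∞ ω u ≤ ENNReal.ofReal b := by
  rw [symNorm, eLpNorm_exponent_top]
  exact eLpNormEssSup_le_of_ae_bound (.of_forall h)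

open Classical in
/-- The configuration with the status of the point `x` changed. -/
def flip (ω : Configuration X) (x : X) : Configuration X :=
  if x ∈ ω.1 then ω.remove x else ω.add x

theorem grad_eq (F : Configuration X → ℝ) (ω : Configuration X) (x : X) :
    grad F ω x = F ω - F (flip ω x) := by
  unfold grad flip; split_ifs <;> rfl

/-- If `u` is at least `b` wherever `v` does not vanish and `v` is not almost everywhere zero,
then the norm of `u` is at least `b`. -/
theorem ofReal_le_symNorm_top {ω : Configuration X} {u v : X → ℝ} {b : ℝ}
    (h : ∀ x, v x ≠ 0 → b ≤ u x) (hv : symNorm σ ∞ ω v ≠ 0) :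
    ENNReal.ofReal b ≤ symNorm σ ∞ ω u := by
  by_contra! hlt
  refine hv ?_
  unfold symNorm at hlt ⊢
  rw [eLpNorm_exponent_top] at hlt ⊢
  rw [eLpNormEssSup_eq_zero_iff]
  filter_upwards [ae_le_eLpNormEssSup (f := u)
    (μ := (2⁻¹ : ℝ≥0∞) • (σ + ω.toMeasure))] with x hx
  by_contra hvx
  have h1 := h x hvx
  have h2 := hx.trans_lt hlt
  rw [Real.enorm_eq_ofReal_abs] at h2
  exact (not_le.2 h2) (ENNReal.ofReal_le_ofReal (h1.trans (le_abs_self _)))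

variable {π : Measure (Configuration X)} [IsProbabilityMeasure π]

/-- A point `x` contributes to D⁺ of the level indicator only if F(flip ω x) ≤ t < F(ω), and then
D_x⁺F(ω) ≥ F(ω) - t. For D⁻ the two values of F exchange roles. -/
theorem hPos_mul_excess_le {F : Configuration X → ℝ} (hF : Measurable F) :
    hPos σ π ∞ * excess π F ≤ ∫⁻ ω, symNorm σ ∞ ω (gradPos F ω) ∂π := by
  classical
  refine mul_excess_le (fun F ω => symNorm σ ∞ ω (gradPos F ω)) (s := -1) (Or.inr rfl) hF ?_ ?_ ?_
  · intro A ω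
    refine (symNorm_top_le (b := 1) fun x => ?_).trans (by simp)
    rw [gradPos, grad_eq, Set.indicator_apply, Set.indicator_apply]
    split_ifs <;> norm_num
  · intro t ω hne
    have hsupp : ∀ x, gradPos ({η | t < F η}.indicator fun _ => 1) ω x ≠ 0 →
        t < F ω ∧ F (flip ω x) ≤ t := by
      intro x hx
      rw [gradPos, grad_eq, Set.indicator_apply, Set.indicator_apply] at hx
      simp only [Set.mem_ofPred_eq] at hx
      split_ifs at hx with h1 h2 h2 <;> first | exact ⟨h1, not_lt.1 h2⟩ | (norm_num at hx)
    constructor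
    · by_contra hlt
      refine hne (le_antisymm ((symNorm_top_le (b := 0) fun x => ?_).trans (by simp)) zero_le)
      by_contra hx
      have := (hsupp x fun h0 => hx (by simp [h0])).1
      exact hlt (by linarith)
    · refine ofReal_le_symNorm_top (fun x hx => ?_) hne
      rw [gradPos, grad_eq]
      exact le_max_of_le_right (by linarith [(hsupp x hx).2])
  · intro A hA h0 h1
    rw [← ENNReal.le_div_iff_mul_le (Or.inl h0.ne') (Or.inl (measure_ne_top _ _))]
    exact iInf₂_le_of_le A hA (iInf₂_le h0 h1)

theorem hNeg_mul_excess_le {F : Configuration X → ℝ} (hF : Measurable F) :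
    hNeg σ π ∞ * excess π F ≤ ∫⁻ ω, symNorm σ ∞ ω (gradNeg F ω) ∂π := by
  classical
  refine mul_excess_le (fun F ω => symNorm σ ∞ ω (gradNeg F ω)) (s := 1) (Or.inl rfl) hF ?_ ?_ ?_
  · intro A ω
    refine (symNorm_top_le (b := 1) fun x => ?_).trans (by simp)
    rw [gradNeg, grad_eq, Set.indicator_apply, Set.indicator_apply]
    split_ifs <;> norm_num
  · intro t ω hne
    have hsupp : ∀ x, gradNeg ({η | t < F η}.indicator fun _ => 1) ω x ≠ 0 →
        F ω ≤ t ∧ t < F (flip ω x) := by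
      intro x hx
      rw [gradNeg, grad_eq, Set.indicator_apply, Set.indicator_apply] at hx
      simp only [Set.mem_ofPred_eq] at hx
      split_ifs at hx with h1 h2 h2 <;> first | exact ⟨not_lt.1 h1, h2⟩ | (norm_num at hx)
    constructor
    · by_contra hlt
      refine hne (le_antisymm ((symNorm_top_le (b := 0) fun x => ?_).trans (by simp)) zero_le)
      by_contra hx
      have := (hsupp x fun h0 => hx (by simp [h0])).1
      exact hlt (by linarith)
    · refine ofReal_le_symNorm_top (fun x hx => ?_) hne
      rw [gradNeg, grad_eq]
      have h2 := (hsupp x hx).2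
      have h3 := min_le_right 0 (F ω - F (flip ω x))
      linarith
  · intro A hA h0 h1
    rw [← ENNReal.le_div_iff_mul_le (Or.inl h0.ne') (Or.inl (measure_ne_top _ _))]
    exact iInf₂_le_of_le A hA (iInf₂_le h0 h1)

theorem kPos_eq_hPos : kPos σ π ∞ = hPos σ π ∞ := by
  refine le_antisymm (le_iInf₂ fun A hA => le_iInf₂ fun h0 h1 => ?_)
    (le_iInf₂ fun F hF => le_iInf₂ fun h0 h1 => ?_)
  · have he := excess_indicator hA h1
    refine iInf₂_le_of_le (A.indicator fun _ => 1) (measurable_const.indicator hA)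
      (iInf₂_le_of_le (he ▸ h0.ne') (he ▸ measure_ne_top _ _) ?_)
    rw [he]
  · rw [ENNReal.le_div_iff_mul_le (Or.inl h0) (Or.inl h1)]
    exact hPos_mul_excess_le hF

theorem kNeg_eq_hNeg : kNeg σ π ∞ = hNeg σ π ∞ := by
  refine le_antisymm (le_iInf₂ fun A hA => le_iInf₂ fun h0 h1 => ?_)
    (le_iInf₂ fun F hF => le_iInf₂ fun h0 h1 => ?_)
  · have he := excess_indicator hA h1
    refine iInf₂_le_of_le (A.indicator fun _ => 1) (measurable_const.indicator hA)
      (iInf₂_le_of_le (he ▸ h0.ne') (he ▸ measure_ne_top _ _) ?_)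
    rw [he]
  · rw [ENNReal.le_div_iff_mul_le (Or.inl h0) (Or.inl h1)]
    exact hNeg_mul_excess_le hF

end Constants

/-! ### Real moments of the Poisson distribution -/

section Moments

variable (r : ℝ≥0)

theorem integrable_poissonMeasure_of_le {f : ℕ → ℝ} {C : ℝ} (h : ∀ n : ℕ, |f n| ≤ C * (n ^ 2 + 1)) :
    Integrable f (poissonMeasure r) := by
  have h2 : Integrable (fun n : ℕ => (n : ℝ) ^ 2) (poissonMeasure r) := by
    refine ⟨.of_discrete, ?_⟩
    have := lintegral_natCast_sq_poissonMeasure r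
    simp only [HasFiniteIntegral, enorm_pow, Real.enorm_natCast]
    rw [this]
    finiteness
  exact ((h2.add (integrable_const 1)).const_mul C).mono' .of_discrete (.of_forall h)

theorem integral_natCast_poissonMeasure : ∫ n, (n : ℝ) ∂poissonMeasure r = r := by
  rw [integral_eq_lintegral_of_nonneg_ae (.of_forall fun n => by positivity) .of_discrete]
  simp [lintegral_natCast_poissonMeasure]

theorem integral_natCast_sq_poissonMeasure :
    ∫ n, (n : ℝ) ^ 2 ∂poissonMeasure r = r * (r + 1) := by
  rw [integral_eq_lintegral_of_nonneg_ae (.of_forall fun n => by positivity) .of_discrete]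
  simp only [ENNReal.ofReal_pow (Nat.cast_nonneg _), ENNReal.ofReal_natCast,
    lintegral_natCast_sq_poissonMeasure]
  norm_cast

theorem integral_sub_sq_poissonMeasure (a : ℝ) :
    ∫ n, ((n : ℝ) - a) ^ 2 ∂poissonMeasure r = r + (r - a) ^ 2 := by
  have h1 : Integrable (fun n : ℕ => (n : ℝ)) (poissonMeasure r) :=
    integrable_poissonMeasure_of_le r (C := 1) fun n => by
      rw [abs_of_nonneg (by positivity)]; nlinarith [sq_nonneg ((n : ℝ) - 1)]
  have h2 : Integrable (fun n : ℕ => (n : ℝ) ^ 2) (poissonMeasure r) :=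
    integrable_poissonMeasure_of_le r (C := 1) fun n => by
      rw [abs_of_nonneg (by positivity)]; linarith
  have : ∀ n : ℕ, ((n : ℝ) - a) ^ 2 = (n : ℝ) ^ 2 - 2 * a * n + a ^ 2 := fun n => by ring
  have h3 : Integrable (fun n : ℕ => (n : ℝ) ^ 2 - 2 * a * n) (poissonMeasure r) :=
    h2.sub (h1.const_mul _)
  simp only [this]
  rw [integral_add h3 (integrable_const _),
    integral_sub h2 (h1.const_mul _), integral_const_mul, integral_natCast_poissonMeasure,
    integral_natCast_sq_poissonMeasure]
  simp
  ring

end Moments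

/-! ### The number of points -/

section Number

variable {X : Type*} [TopologicalSpace X]

/-- The number of points of a configuration, `0` if it is infinite. -/
def card (ω : Configuration X) : ℕ := (ω.count Set.univ).toNat

theorem card_flip {ω : Configuration X} (hω : ω.count Set.univ ≠ ⊤) (x : X) :
    card (flip ω x) = card ω + 1 ∨ card (flip ω x) + 1 = card ω := by
  unfold flip card
  split_ifs with hx
  · right
    have h := count_add_of_mem (notMem_remove ω x) (Set.mem_univ x)
    rw [add_remove hx] at h
    have h' : (ω.remove x).count Set.univ ≠ ⊤ := fun h' => hω (by simp [h, h'])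
    rw [h, ENat.toNat_add h' (by simp)]
    simp
  · left
    rw [count_add_of_mem hx (Set.mem_univ x), ENat.toNat_add hω (by simp)]
    simp

variable [MeasurableSpace X]

theorem measurable_card : Measurable (card (X := X)) :=
  (Measurable.of_discrete (f := ENat.toNat)).comp (measurable_count .univ)

variable {σ : Measure X} [IsFiniteMeasure σ] {π : Measure (Configuration X)}

theorem IsPoissonMeasure.lintegral_count_univ (hπ : IsPoissonMeasure σ π) (f : ℕ∞ → ℝ≥0∞) :
    ∫⁻ ω, f (ω.count Set.univ) ∂π = ∫⁻ n, f n ∂poissonMeasure (σ Set.univ).toNNReal := by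
  have h := hπ.lintegral_counts (c := fun _ : X => (0 : Fin 1)) measurable_const fun v => f (v 0)
  have h1 : ∀ ω : Configuration X, counts (fun _ : X => (0 : Fin 1)) ω 0 = ω.count Set.univ :=
    fun ω => by simp [counts]
  simp only [h1] at h
  rw [h]
  refine ((measurePreserving_eval (fun i : Fin 1 =>
    poissonMeasure (σ ((fun _ => 0) ⁻¹' {i})).toNNReal) 0).lintegral_comp
    (f := fun n : ℕ => f n) .of_discrete).trans ?_
  simp

theorem IsPoissonMeasure.lintegral_card (hπ : IsPoissonMeasure σ π) (f : ℕ → ℝ≥0∞) :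
    ∫⁻ ω, f (card ω) ∂π = ∫⁻ n, f n ∂poissonMeasure (σ Set.univ).toNNReal := by
  simpa [card] using hπ.lintegral_count_univ fun v => f v.toNat

theorem IsPoissonMeasure.ae_count_univ_ne_top (hπ : IsPoissonMeasure σ π) :
    ∀ᵐ ω ∂π, ω.count Set.univ ≠ ⊤ := by
  have h := hπ.lintegral_count_univ fun v => if v = ⊤ then 1 else 0
  have hm : Measurable fun ω : Configuration X =>
      if ω.count Set.univ = ⊤ then (1 : ℝ≥0∞) else 0 :=
    (Measurable.of_discrete (f := fun v : ℕ∞ => if v = ⊤ then (1 : ℝ≥0∞) else 0)).comp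
      (measurable_count .univ)
  simp only [ENat.natCast_ne_top, if_false, lintegral_zero] at h
  rw [lintegral_eq_zero_iff hm] at h
  filter_upwards [h] with ω hω h'
  simp [h'] at hω

theorem IsPoissonMeasure.measure_card (hπ : IsPoissonMeasure σ π) (S : Set ℕ) :
    π {ω | card ω ∈ S} = poissonMeasure (σ Set.univ).toNNReal S := by
  have h := hπ.lintegral_card (S.indicator 1)
  rw [lintegral_indicator_one .of_discrete] at h
  have hS : MeasurableSet (card ⁻¹' S : Set (Configuration X)) := measurable_card .of_discrete
  rw [← h]
  exact (lintegral_indicator_one hS).symm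

/-- The functional inequality for `h⁺`, for functions of the number of points. -/
theorem IsPoissonMeasure.hPos_mul_lintegral_le (hπ : IsPoissonMeasure σ π) {f b : ℕ → ℝ}
    (h0 : ∀ n, 0 ≤ f n)
    (hpos : poissonMeasure (σ Set.univ).toNNReal {n | 0 < f n} < 2⁻¹)
    (hb0 : ∀ n, 0 ≤ b n) (hb1 : ∀ n, f n - f (n + 1) ≤ b n)
    (hb2 : ∀ n, f (n + 1) - f n ≤ b (n + 1)) :
    hPos σ π ∞ * ∫⁻ n, ENNReal.ofReal (f n) ∂poissonMeasure (σ Set.univ).toNNReal ≤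
      ∫⁻ n, ENNReal.ofReal (b n) ∂poissonMeasure (σ Set.univ).toNNReal := by
  have := hπ.isProbabilityMeasure
  have hm : Measurable fun ω : Configuration X => f (card ω) :=
    (Measurable.of_discrete (f := f)).comp measurable_card
  have h := hPos_mul_excess_le (σ := σ) (π := π) hm
  rw [excess_eq_lintegral hm (fun ω => h0 _) ((hπ.measure_card {n | 0 < f n}).trans_lt hpos),
    hπ.lintegral_card fun n => ENNReal.ofReal (f n)] at h
  refine h.trans ?_
  rw [← hπ.lintegral_card fun n => ENNReal.ofReal (b n)]
  refine lintegral_mono_ae ?_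
  filter_upwards [hπ.ae_count_univ_ne_top] with ω hω
  refine symNorm_top_le fun x => ?_
  rw [gradPos, grad_eq, abs_of_nonneg (le_max_left _ _)]
  refine max_le (hb0 _) ?_
  rcases card_flip hω x with h | h
  · rw [h]; exact hb1 _
  · rw [← h]; exact hb2 _

/-- The functional inequality for `h⁻`, for functions of the number of points. -/
theorem IsPoissonMeasure.hNeg_mul_lintegral_le (hπ : IsPoissonMeasure σ π) {f b : ℕ → ℝ}
    (h0 : ∀ n, 0 ≤ f n)
    (hpos : poissonMeasure (σ Set.univ).toNNReal {n | 0 < f n} < 2⁻¹)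
    (hb0 : ∀ n, 0 ≤ b n) (hb1 : ∀ n, f (n + 1) - f n ≤ b n)
    (hb2 : ∀ n, f n - f (n + 1) ≤ b (n + 1)) :
    hNeg σ π ∞ * ∫⁻ n, ENNReal.ofReal (f n) ∂poissonMeasure (σ Set.univ).toNNReal ≤
      ∫⁻ n, ENNReal.ofReal (b n) ∂poissonMeasure (σ Set.univ).toNNReal := by
  have := hπ.isProbabilityMeasure
  have hm : Measurable fun ω : Configuration X => f (card ω) :=
    (Measurable.of_discrete (f := f)).comp measurable_card
  have h := hNeg_mul_excess_le (σ := σ) (π := π) hm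
  rw [excess_eq_lintegral hm (fun ω => h0 _) ((hπ.measure_card {n | 0 < f n}).trans_lt hpos),
    hπ.lintegral_card fun n => ENNReal.ofReal (f n)] at h
  refine h.trans ?_
  rw [← hπ.lintegral_card fun n => ENNReal.ofReal (b n)]
  refine lintegral_mono_ae ?_
  filter_upwards [hπ.ae_count_univ_ne_top] with ω hω
  refine symNorm_top_le fun x => ?_
  rw [gradNeg, grad_eq, ← max_neg_neg, neg_zero, neg_sub, abs_of_nonneg (le_max_left _ _)]
  refine max_le (hb0 _) ?_
  rcases card_flip hω x with h | h
  · rw [h]; exact hb1 _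
  · rw [← h]; exact hb2 _

/-! ### The Poincaré constant -/

theorem IsPoissonMeasure.evariance_card (hπ : IsPoissonMeasure σ π) :
    evariance (fun ω => (card ω : ℝ)) π = σ Set.univ := by
  set r := (σ Set.univ).toNNReal with hr
  have hmap : π.map card = poissonMeasure r := by
    ext S hS
    rw [Measure.map_apply measurable_card hS]
    exact hπ.measure_card S
  have hmean : ∫ ω, (card ω : ℝ) ∂π = r := by
    rw [← integral_natCast_poissonMeasure r, ← hmap,
      integral_map measurable_card.aemeasurable .of_discrete]
  rw [evariance, hmean, hπ.lintegral_card fun n => ‖(n : ℝ) - r‖ₑ ^ 2]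
  have h : ∀ n : ℕ, ‖(n : ℝ) - r‖ₑ ^ 2 = ENNReal.ofReal (((n : ℝ) - r) ^ 2) := fun n => by
    rw [Real.enorm_eq_ofReal_abs, ← ENNReal.ofReal_pow (abs_nonneg _), sq_abs]
  simp only [h]
  rw [← ofReal_integral_eq_lintegral_ofReal, integral_sub_sq_poissonMeasure]
  · simp [hr]
  · refine integrable_poissonMeasure_of_le r (C := 2 + 2 * (r : ℝ) ^ 2) fun n => ?_
    rw [abs_of_nonneg (sq_nonneg _)]
    nlinarith [sq_nonneg ((n : ℝ) + r), sq_nonneg ((n : ℝ) * r)]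
  · exact .of_forall fun n => sq_nonneg _

theorem IsPoissonMeasure.memLp_card (hπ : IsPoissonMeasure σ π) :
    MemLp (fun ω => (card ω : ℝ)) 2 π := by
  have := hπ.isProbabilityMeasure
  have hm : Measurable fun ω : Configuration X => (card ω : ℝ) :=
    (Measurable.of_discrete (f := fun n : ℕ => (n : ℝ))).comp measurable_card
  rw [← evariance_lt_top_iff_memLp hm.aestronglyMeasurable, hπ.evariance_card]
  exact measure_lt_top _ _

variable [MeasurableSingletonClass X] [NullSingletonClass σ]

/-- The essential supremum for (σ + ω)/2 dominates the one for σ, and σ-almost every `x` is a point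
to be added. -/
theorem ae_enorm_add_sub_le_symNorm (F : Configuration X → ℝ) (ω : Configuration X) :
    ∀ᵐ x ∂σ, ‖F (ω.add x) - F ω‖ₑ ≤ symNorm σ ∞ ω (grad F ω) := by
  have h := ae_le_eLpNormEssSup (f := grad F ω) (μ := (2⁻¹ : ℝ≥0∞) • (σ + ω.toMeasure))
  rw [Measure.ae_ennreal_smul_measure_iff (by simp), ae_add_measure_iff] at h
  filter_upwards [h.1, ae_notMem σ ω] with x hx hxω
  rw [symNorm, eLpNorm_exponent_top]
  refine le_trans (le_of_eq ?_) hx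
  rw [grad, if_neg hxω, ← enorm_neg, neg_sub]

theorem IsPoissonMeasure.poincareConst_eq (hπ : IsPoissonMeasure σ π) :
    poincareConst σ π ∞ = (σ Set.univ)⁻¹ := by
  have := hπ.isProbabilityMeasure
  refine le_antisymm ?_ (le_iInf₂ fun F hF => le_iInf₂ fun hFL hv => ?_)
  · rcases eq_or_ne (σ Set.univ) 0 with h0 | h0
    · simp [h0]
    have hm : Measurable fun ω : Configuration X => (card ω : ℝ) :=
      (Measurable.of_discrete (f := fun n : ℕ => (n : ℝ))).comp measurable_card
    refine iInf₂_le_of_le _ hm (iInf₂_le_of_le hπ.memLp_card (by rwa [hπ.evariance_card]) ?_)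
    rw [hπ.evariance_card, ← one_div]
    gcongr
    calc _ ≤ ∫⁻ _, 1 ∂π := by
          refine lintegral_mono_ae ?_
          filter_upwards [hπ.ae_count_univ_ne_top] with ω hω
          refine pow_le_one' ((symNorm_top_le (b := 1) fun x => ?_).trans (by simp)) 2
          rw [grad_eq]
          rcases card_flip hω x with h | h
          · simp [h]
          · simp [← h]
      _ = 1 := by simp
  · have h := hπ.evariance_le hF hFL (ae_enorm_add_sub_le_symNorm F)
    have hfin : evariance F π ≠ ∞ := hFL.evariance_ne_top
    rcases eq_or_ne (σ Set.univ) 0 with h0 | h0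
    · rw [h0, zero_mul] at h
      exact absurd (le_antisymm h zero_le) hv
    rw [ENNReal.le_div_iff_mul_le (Or.inl hv) (Or.inl hfin), mul_comm, ← div_eq_mul_inv,
      ENNReal.div_le_iff_le_mul (Or.inl h0) (Or.inl (measure_ne_top _ _)), mul_comm]
    exact h

end Number

/-! ### The Poisson distribution around its median -/

theorem poissonMeasure_singleton_pos {r : ℝ≥0} (hr : r ≠ 0) (n : ℕ) :
    0 < poissonMeasure r {n} := by
  have : (0 : ℝ) < r := by positivity
  rw [poissonMeasure_singleton, ENNReal.ofReal_pos]
  positivity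

theorem natCast_mul_poissonMeasure_le (r : ℝ≥0) (n : ℕ) :
    (n : ℝ≥0∞) * poissonMeasure r {k | n ≤ k} ≤ r := by
  rw [← lintegral_natCast_poissonMeasure r]
  refine le_trans (le_of_eq ?_) (mul_meas_ge_le_lintegral₀ (Measurable.of_discrete).aemeasurable n)
  simp

/-- Take the least `m` with P(N > m) < 1/2. If m = k + 1, then P(N > k) ≥ 1/2 and P(N = k) > 0 force
P(N < k) < 1/2, and Markov's inequality applied to P(N ≥ m) ≥ 1/2 gives m ≤ 2r. -/
theorem exists_poissonMeasure_median {r : ℝ≥0} (hr : r ≠ 0) :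
    ∃ m : ℕ, poissonMeasure r {n | m < n} < 2⁻¹ ∧ poissonMeasure r {n | n + 1 < m} < 2⁻¹ ∧
      (m : ℝ) ≤ 2 * r := by
  have hex : ∃ m : ℕ, poissonMeasure r {n | m < n} < 2⁻¹ := by
    obtain ⟨m, hm⟩ := exists_nat_gt (2 * r)
    refine ⟨m, lt_of_not_ge fun h => ?_⟩
    have h1 := natCast_mul_poissonMeasure_le r (m + 1)
    have h2 : ((m + 1 : ℕ) : ℝ≥0∞) * 2⁻¹ ≤ r := le_trans (by gcongr; exact h) h1
    rw [← div_eq_mul_inv, ENNReal.div_le_iff (by simp) (by simp)] at h2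
    have h3 : ((m + 1 : ℕ) : ℝ≥0) ≤ r * 2 := by exact_mod_cast h2
    push_cast at h3
    have := h3.trans_lt ((mul_comm r 2).trans_lt hm)
    exact absurd this (by simp)
  classical
  obtain ⟨m, hm, hmin⟩ : ∃ m : ℕ, poissonMeasure r {n | m < n} < 2⁻¹ ∧
      ∀ k < m, ¬poissonMeasure r {n | k < n} < 2⁻¹ :=
    ⟨Nat.find hex, Nat.find_spec hex, fun k hk => Nat.find_min hex hk⟩
  refine ⟨m, hm, ?_⟩
  cases m with
  | zero => simp
  | succ k =>
    have hk : 2⁻¹ ≤ poissonMeasure r {n | k < n} := not_lt.1 (hmin k k.lt_succ_self)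
    constructor
    · have hdisj : poissonMeasure r {n | n < k} + poissonMeasure r {k} +
          poissonMeasure r {n | k < n} = 1 := by
        rw [← measure_union (by simp) .of_discrete, ← measure_union _ .of_discrete,
          ← measure_univ (μ := poissonMeasure r)]
        · congr 1
          ext n
          simp only [Set.mem_union, Set.mem_ofPred_eq, Set.mem_singleton_iff, Set.mem_univ, iff_true]
          omega
        · rw [Set.disjoint_left]
          simp only [Set.mem_union, Set.mem_ofPred_eq, Set.mem_singleton_iff]
          omega
      by_contra! h
      have h' : 2⁻¹ ≤ poissonMeasure r {n | n < k} := by simpa using h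
      have h1 : 1 + poissonMeasure r {k} ≤ 1 := by
        calc 1 + poissonMeasure r {k} = 2⁻¹ + poissonMeasure r {k} + 2⁻¹ := by
              rw [add_right_comm, ENNReal.inv_two_add_inv_two]
          _ ≤ _ := add_le_add (add_le_add h' le_rfl) hk
          _ = 1 := hdisj
      have h2 : (1 : ℝ≥0∞) < 1 + poissonMeasure r {k} :=
        ENNReal.lt_add_right (by simp) (poissonMeasure_singleton_pos hr k).ne'
      exact absurd h1 h2.not_ge
    · have h1 := natCast_mul_poissonMeasure_le r (k + 1)
      have h2 : ((k + 1 : ℕ) : ℝ≥0∞) * 2⁻¹ ≤ r := le_trans (by gcongr; exact hk) h1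
      rw [← div_eq_mul_inv, ENNReal.div_le_iff (by simp) (by simp)] at h2
      have h3 : ((k + 1 : ℕ) : ℝ≥0) ≤ r * 2 := by exact_mod_cast h2
      have h4 : ((k + 1 : ℕ) : ℝ) ≤ r * 2 := by exact_mod_cast h3
      linarith

/-- The distance of `n` to `m` if `m ≤ n`, and `0` otherwise. -/
def above (m n : ℕ) : ℝ := (n - m : ℕ)

/-- The distance of `n` to `m - 1` if `n < m`, and `0` otherwise. -/
def below (m n : ℕ) : ℝ := (m - 1 - n : ℕ)

theorem above_below_cases (m n : ℕ) :
    (m ≤ n ∧ above m n = n - m ∧ below m n = 0) ∨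
      (n + 1 ≤ m ∧ above m n = 0 ∧ below m n = m - 1 - n) := by
  unfold above below
  rcases le_or_gt m n with h | h
  · exact .inl ⟨h, by rw [Nat.cast_sub h], by rw [Nat.cast_eq_zero]; omega⟩
  · refine .inr ⟨h, by rw [Nat.cast_eq_zero]; omega, ?_⟩
    rw [Nat.cast_sub (by omega), Nat.cast_sub (by omega), Nat.cast_one]

theorem above_succ_cases (m n : ℕ) :
    (m ≤ n ∧ above m (n + 1) = above m n + 1) ∨
      (n + 1 ≤ m ∧ above m n = 0 ∧ above m (n + 1) = 0) := by
  unfold above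
  rcases le_or_gt m n with h | h
  · exact .inl ⟨h, by rw [Nat.sub_add_comm h]; push_cast; rfl⟩
  · refine .inr ⟨h, ?_, ?_⟩ <;> (rw [Nat.cast_eq_zero]; omega)

theorem below_succ_cases (m n : ℕ) :
    (n + 1 < m ∧ below m n = below m (n + 1) + 1) ∨
      (m ≤ n + 1 ∧ below m n = 0 ∧ below m (n + 1) = 0) := by
  unfold below
  rcases lt_or_ge (n + 1) m with h | h
  · exact .inl ⟨h, by rw [show m - 1 - n = m - 1 - (n + 1) + 1 by omega]; push_cast; rfl⟩
  · refine .inr ⟨h, ?_, ?_⟩ <;> (rw [Nat.cast_eq_zero]; omega)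

theorem above_nonneg (m n : ℕ) : 0 ≤ above m n := Nat.cast_nonneg _

theorem below_nonneg (m n : ℕ) : 0 ≤ below m n := Nat.cast_nonneg _

theorem above_mul_below (m n : ℕ) : above m n * below m n = 0 := by
  rcases above_below_cases m n with ⟨-, h1, h2⟩ | ⟨-, h1, h2⟩ <;> simp [h1, h2]

theorem sq_above_pos_iff (m n : ℕ) : 0 < above m n ^ 2 ↔ m < n := by
  simp [above, sq_pos_iff, Nat.sub_eq_zero_iff_le]

theorem sq_below_pos_iff (m n : ℕ) : 0 < below m n ^ 2 ↔ n + 1 < m := by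
  rw [below, sq_pos_iff, Nat.cast_ne_zero]
  omega

/-! ### Moments of the distance to the median -/

section Integrals

variable (r : ℝ≥0) (m : ℕ)

theorem integrable_sq_above : Integrable (fun n => above m n ^ 2) (poissonMeasure r) := by
  refine integrable_poissonMeasure_of_le r (C := 1) fun n => ?_
  have h : above m n ≤ n := Nat.cast_le.2 (Nat.sub_le n m)
  rw [abs_of_nonneg (sq_nonneg _)]
  nlinarith [above_nonneg m n]

theorem integrable_above : Integrable (above m) (poissonMeasure r) := by
  refine ((integrable_sq_above r m).add (integrable_const 1)).mono' .of_discrete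
    (.of_forall fun n => ?_)
  rw [Real.norm_of_nonneg (above_nonneg m n), Pi.add_apply]
  nlinarith [sq_nonneg (above m n - 1)]

theorem below_le (n : ℕ) : below m n ≤ m := Nat.cast_le.2 (by omega)

theorem integrable_sq_below : Integrable (fun n => below m n ^ 2) (poissonMeasure r) := by
  refine (integrable_const ((m : ℝ) ^ 2)).mono' .of_discrete (.of_forall fun n => ?_)
  rw [Real.norm_of_nonneg (sq_nonneg _)]
  exact pow_le_pow_left₀ (below_nonneg m n) (below_le m n) 2

theorem integrable_below : Integrable (below m) (poissonMeasure r) := by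
  refine (integrable_const (m : ℝ)).mono' .of_discrete (.of_forall fun n => ?_)
  rw [Real.norm_of_nonneg (below_nonneg m n)]
  exact below_le m n

/-- The first moment of the distance to the median. -/
def absMoment : ℝ := ∫ n, above m n ∂poissonMeasure r + ∫ n, below m n ∂poissonMeasure r

/-- The second moment of the distance to the median. -/
def sqMoment : ℝ :=
  ∫ n, above m n ^ 2 ∂poissonMeasure r + ∫ n, below m n ^ 2 ∂poissonMeasure r

theorem integrable_quadratic (s t c : ℝ) :
    Integrable (fun n => s * (above m n + below m n) + t * (above m n ^ 2 + below m n ^ 2) + c)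
      (poissonMeasure r) :=
  ((((integrable_above r m).add (integrable_below r m)).const_mul s).add
    (((integrable_sq_above r m).add (integrable_sq_below r m)).const_mul t)).add
    (integrable_const c)

theorem integral_quadratic (s t c : ℝ) :
    ∫ n, (s * (above m n + below m n) + t * (above m n ^ 2 + below m n ^ 2) + c)
      ∂poissonMeasure r = s * absMoment r m + t * sqMoment r m + c := by
  have h1 := (integrable_above r m).add (integrable_below r m)
  have h2 := (integrable_sq_above r m).add (integrable_sq_below r m)
  have e1 := integral_add (integrable_above r m) (integrable_below r m)
  have e2 := integral_add (integrable_sq_above r m) (integrable_sq_below r m)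
  have e3 := integral_add (h1.const_mul s) (h2.const_mul t)
  have e4 := integral_add ((h1.const_mul s).add (h2.const_mul t))
    (integrable_const (μ := poissonMeasure r) c)
  rw [integral_const_mul, integral_const_mul] at e3
  simp only [Pi.add_apply, integral_const, probReal_univ, one_smul] at e1 e2 e3 e4
  rw [e4, e3, e1, e2, absMoment, sqMoment]

theorem absMoment_nonneg : 0 ≤ absMoment r m :=
  add_nonneg (integral_nonneg (above_nonneg m)) (integral_nonneg (below_nonneg m))

/-- The two distances are never both nonzero, so the square of their sum is the sum of their
squares, and this is Jensen's inequality. -/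
theorem absMoment_sq_le : absMoment r m ^ 2 ≤ sqMoment r m := by
  have h : ∀ u : ℝ, 2 * u * absMoment r m - u ^ 2 ≤ sqMoment r m := fun u => by
    have : ∫ n, (2 * u * (above m n + below m n) + (-1) * (above m n ^ 2 + below m n ^ 2) + -u ^ 2)
        ∂poissonMeasure r ≤ ∫ _, 0 ∂poissonMeasure r := by
      refine integral_mono (integrable_quadratic r m _ _ _) (integrable_const 0) fun n => ?_
      have := above_mul_below m n
      simp only
      nlinarith [sq_nonneg (above m n + below m n - u)]
    rw [integral_quadratic, integral_zero] at this
    linarith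
  nlinarith [h (absMoment r m)]

/-- The distance of `n` to m - 1/2 is `above + 1/2` or `below + 1/2`, and the mean square distance
to any point is at least the variance r. Measuring `below` from m - 1 creates this symmetry. -/
theorem le_sqMoment_add_absMoment : (r : ℝ) ≤ sqMoment r m + absMoment r m + 1 / 4 := by
  have h1 := integral_sub_sq_poissonMeasure r (m - 1 / 2)
  have h2 : ∀ n : ℕ, ((n : ℝ) - (m - 1 / 2)) ^ 2 =
      1 * (above m n + below m n) + 1 * (above m n ^ 2 + below m n ^ 2) + 1 / 4 := fun n => by
    rcases above_below_cases m n with ⟨-, h1, h2⟩ | ⟨-, h1, h2⟩ <;> rw [h1, h2] <;> ring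
  simp only [h2] at h1
  rw [integral_quadratic] at h1
  nlinarith [sq_nonneg ((r : ℝ) - (m - 1 / 2))]

theorem integral_sq_above_pos {r : ℝ≥0} (hr : r ≠ 0) :
    0 < ∫ n, above m n ^ 2 ∂poissonMeasure r := by
  rw [integral_pos_iff_support_of_nonneg (fun n => sq_nonneg _) (integrable_sq_above r m)]
  refine (poissonMeasure_singleton_pos hr (m + 1)).trans_le (measure_mono ?_)
  simp [above]

theorem sqMoment_pos {r : ℝ≥0} (hr : r ≠ 0) : 0 < sqMoment r m :=
  add_pos_of_pos_of_nonneg (integral_sq_above_pos m hr) (integral_nonneg fun _ => sq_nonneg _)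

end Integrals

/-! ### From extended to real inequalities -/

theorem toReal_mul_integral_le {α : Type*} [MeasurableSpace α] {μ : Measure α} {f b : α → ℝ}
    {a : ℝ≥0∞} (hf : Integrable f μ) (hb : Integrable b μ) (hf0 : 0 ≤ f) (hb0 : 0 ≤ b)
    (h : a * ∫⁻ x, ENNReal.ofReal (f x) ∂μ ≤ ∫⁻ x, ENNReal.ofReal (b x) ∂μ) :
    a.toReal * ∫ x, f x ∂μ ≤ ∫ x, b x ∂μ := by
  rw [← ofReal_integral_eq_lintegral_ofReal hf (.of_forall hf0),
    ← ofReal_integral_eq_lintegral_ofReal hb (.of_forall hb0)] at h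
  have := ENNReal.toReal_mono (by simp) h
  rwa [ENNReal.toReal_mul, ENNReal.toReal_ofReal (integral_nonneg hf0),
    ENNReal.toReal_ofReal (integral_nonneg hb0)] at this

theorem ne_top_of_mul_lintegral_le {α : Type*} [MeasurableSpace α] {μ : Measure α} {f b : α → ℝ}
    {a : ℝ≥0∞} (hf : Integrable f μ) (hb : Integrable b μ) (hf0 : 0 ≤ f) (hb0 : 0 ≤ b)
    (hpos : 0 < ∫ x, f x ∂μ)
    (h : a * ∫⁻ x, ENNReal.ofReal (f x) ∂μ ≤ ∫⁻ x, ENNReal.ofReal (b x) ∂μ) : a ≠ ∞ := by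
  rintro rfl
  rw [← ofReal_integral_eq_lintegral_ofReal hf (.of_forall hf0),
    ← ofReal_integral_eq_lintegral_ofReal hb (.of_forall hb0),
    ENNReal.top_mul (by simpa using hpos), top_le_iff] at h
  exact ENNReal.ofReal_ne_top h

/-! ### Upper bounds for `h⁺` and `h⁻` -/

section Bounds

variable {X : Type*} [TopologicalSpace X] [MeasurableSpace X] {σ : Measure X} [IsFiniteMeasure σ]
  {π : Measure (Configuration X)}

/-- At distance k ≥ 1 the decrement of the square is 2k - 1, at distance 0 it is 0. Both are at most
(2 - 2u)k + u²k², since (1 - uk)² ≥ 0. This quadratic has no constant term, so the atom at distance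
0 needs no separate estimate. -/
theorem IsPoissonMeasure.hPos_mul_sqMoment_le (hπ : IsPoissonMeasure σ π)
    {r : ℝ≥0} (hr : (σ Set.univ).toNNReal = r) (hr0 : r ≠ 0) {m : ℕ}
    (hm1 : poissonMeasure r {n | m < n} < 2⁻¹) (hm2 : poissonMeasure r {n | n + 1 < m} < 2⁻¹)
    (u : ℝ) :
    hPos σ π ∞ ≠ ∞ ∧ (hPos σ π ∞).toReal * sqMoment r m ≤
      (2 - 2 * u) * absMoment r m + u ^ 2 * sqMoment r m := by
  subst hr
  set r := (σ Set.univ).toNNReal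
  have hb : ∀ k : ℕ, 0 ≤ (2 - 2 * u) * (k : ℝ) + u ^ 2 * (k : ℝ) ^ 2 := fun k => by
    rcases Nat.eq_zero_or_pos k with rfl | hk
    · simp
    · have : (1 : ℝ) ≤ k := by exact_mod_cast hk
      nlinarith [sq_nonneg (1 - u * k)]
  have hU := hπ.hPos_mul_lintegral_le (f := fun n => above m n ^ 2)
    (b := fun n => (2 - 2 * u) * above m n + u ^ 2 * above m n ^ 2) (fun n => sq_nonneg _)
    (by simpa only [sq_above_pos_iff] using hm1) (fun n => hb _)
    (fun n => by
      refine le_trans ?_ (hb _)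
      rcases above_succ_cases m n with ⟨-, h⟩ | ⟨-, h, h'⟩
      · nlinarith [above_nonneg m n]
      · simp [h, h'])
    (fun n => by
      rcases above_succ_cases m n with ⟨-, h⟩ | ⟨-, h, h'⟩
      · nlinarith [sq_nonneg (1 - u * above m (n + 1))]
      · simp [h, h'])
  have hL := hπ.hPos_mul_lintegral_le (f := fun n => below m n ^ 2)
    (b := fun n => (2 - 2 * u) * below m n + u ^ 2 * below m n ^ 2) (fun n => sq_nonneg _)
    (by simpa only [sq_below_pos_iff] using hm2) (fun n => hb _)
    (fun n => by
      rcases below_succ_cases m n with ⟨-, h⟩ | ⟨-, h, h'⟩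
      · nlinarith [sq_nonneg (1 - u * below m n)]
      · simp [h, h'])
    (fun n => by
      refine le_trans ?_ (hb _)
      rcases below_succ_cases m n with ⟨-, h⟩ | ⟨-, h, h'⟩
      · nlinarith [below_nonneg m (n + 1)]
      · simp [h, h'])
  have iU : Integrable (fun n => (2 - 2 * u) * above m n + u ^ 2 * above m n ^ 2)
      (poissonMeasure r) :=
    ((integrable_above r m).const_mul _).add ((integrable_sq_above r m).const_mul _)
  have iL : Integrable (fun n => (2 - 2 * u) * below m n + u ^ 2 * below m n ^ 2)
      (poissonMeasure r) :=
    ((integrable_below r m).const_mul _).add ((integrable_sq_below r m).const_mul _)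
  refine ⟨ne_top_of_mul_lintegral_le (integrable_sq_above r m) iU (fun n => sq_nonneg _)
    (fun n => hb _) (integral_sq_above_pos m hr0) hU, ?_⟩
  have hU' := toReal_mul_integral_le (integrable_sq_above r m) iU (fun n => sq_nonneg _)
    (fun n => hb _) hU
  have hL' := toReal_mul_integral_le (integrable_sq_below r m) iL (fun n => sq_nonneg _)
    (fun n => hb _) hL
  rw [integral_add ((integrable_above r m).const_mul _) ((integrable_sq_above r m).const_mul _),
    integral_const_mul, integral_const_mul] at hU'
  rw [integral_add ((integrable_below r m).const_mul _) ((integrable_sq_below r m).const_mul _),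
    integral_const_mul, integral_const_mul] at hL'
  rw [absMoment, sqMoment]
  linarith

theorem IsPoissonMeasure.hNeg_mul_sqMoment_le (hπ : IsPoissonMeasure σ π)
    {r : ℝ≥0} (hr : (σ Set.univ).toNNReal = r) (hr0 : r ≠ 0) {m : ℕ}
    (hm1 : poissonMeasure r {n | m < n} < 2⁻¹) (hm2 : poissonMeasure r {n | n + 1 < m} < 2⁻¹) :
    hNeg σ π ∞ ≠ ∞ ∧ (hNeg σ π ∞).toReal * sqMoment r m ≤ 2 * absMoment r m + 1 := by
  subst hr
  set r := (σ Set.univ).toNNReal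
  -- The increment 2k + 1 is charged only on the half-line of the test function, so the two
  -- constants add up to 1 instead of 2.
  have hbU : ∀ n, 0 ≤ 2 * above m n + (if m ≤ n then 1 else 0) := fun n =>
    add_nonneg (mul_nonneg zero_le_two (above_nonneg m n)) (by split_ifs <;> simp)
  have hbL : ∀ n, 0 ≤ 2 * below m n + (if m ≤ n then 0 else 1) := fun n =>
    add_nonneg (mul_nonneg zero_le_two (below_nonneg m n)) (by split_ifs <;> simp)
  have hU := hπ.hNeg_mul_lintegral_le (f := fun n => above m n ^ 2)
    (b := fun n => 2 * above m n + (if m ≤ n then 1 else 0)) (fun n => sq_nonneg _)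
    (by simpa only [sq_above_pos_iff] using hm1) hbU
    (fun n => by
      rcases above_succ_cases m n with ⟨h0, h⟩ | ⟨-, h, h'⟩
      · rw [if_pos h0]; nlinarith
      · rw [h']; linarith [hbU n, sq_nonneg (above m n)])
    (fun n => by
      refine le_trans ?_ (hbU _)
      rcases above_succ_cases m n with ⟨-, h⟩ | ⟨-, h, h'⟩
      · nlinarith [above_nonneg m n]
      · simp [h, h'])
  have hL := hπ.hNeg_mul_lintegral_le (f := fun n => below m n ^ 2)
    (b := fun n => 2 * below m n + (if m ≤ n then 0 else 1)) (fun n => sq_nonneg _)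
    (by simpa only [sq_below_pos_iff] using hm2) hbL
    (fun n => by
      refine le_trans ?_ (hbL _)
      rcases below_succ_cases m n with ⟨-, h⟩ | ⟨-, h, h'⟩
      · nlinarith [below_nonneg m (n + 1)]
      · simp [h, h'])
    (fun n => by
      rcases below_succ_cases m n with ⟨h0, h⟩ | ⟨-, h, h'⟩
      · rw [if_neg h0.not_ge]; nlinarith
      · rw [h]; linarith [hbL (n + 1), sq_nonneg (below m (n + 1))])
  have i0 : ∀ s t : ℝ, Integrable (fun n => if m ≤ n then s else t) (poissonMeasure r) :=
    fun s t => (integrable_const (max |s| |t|)).mono' .of_discrete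
      (.of_forall fun _ => by split_ifs <;> simp)
  have iU : Integrable (fun n => 2 * above m n + (if m ≤ n then (1 : ℝ) else 0))
      (poissonMeasure r) := ((integrable_above r m).const_mul _).add (i0 _ _)
  have iL : Integrable (fun n => 2 * below m n + (if m ≤ n then (0 : ℝ) else 1))
      (poissonMeasure r) := ((integrable_below r m).const_mul _).add (i0 _ _)
  refine ⟨ne_top_of_mul_lintegral_le (integrable_sq_above r m) iU (fun n => sq_nonneg _) hbU
    (integral_sq_above_pos m hr0) hU, ?_⟩
  have hU' := toReal_mul_integral_le (integrable_sq_above r m) iU (fun n => sq_nonneg _) hbU hU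
  have hL' := toReal_mul_integral_le (integrable_sq_below r m) iL (fun n => sq_nonneg _) hbL hL
  have h : ∀ n, 2 * above m n + (if m ≤ n then 1 else 0) +
      (2 * below m n + (if m ≤ n then 0 else 1)) =
      2 * (above m n + below m n) + 0 * (above m n ^ 2 + below m n ^ 2) + 1 := fun n => by
    split_ifs <;> ring
  have hsum := integral_add iU iL
  simp only [h, integral_quadratic] at hsum
  rw [sqMoment]
  linarith

/-- For the event {N > m}, D⁻ lives on {N = m}. Hence h⁻P(N = m + 1) ≤ h⁻P(N > m) ≤ P(N = m), and
consecutive Poisson weights have ratio r/(m + 1). -/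
theorem IsPoissonMeasure.hNeg_mul_le (hπ : IsPoissonMeasure σ π)
    {r : ℝ≥0} (hr : (σ Set.univ).toNNReal = r) (hr0 : r ≠ 0) {m : ℕ}
    (hm1 : poissonMeasure r {n | m < n} < 2⁻¹) :
    (hNeg σ π ∞).toReal * r ≤ m + 1 := by
  subst hr
  set r := (σ Set.univ).toNNReal
  have h := hπ.hNeg_mul_lintegral_le (f := fun n => if m < n then 1 else 0)
    (b := fun n => if n = m then 1 else 0) (fun n => by split_ifs <;> simp)
    (lt_of_le_of_lt (measure_mono fun n hn => by
      by_contra h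
      rw [Set.mem_ofPred_eq, if_neg (show ¬m < n from h)] at hn
      exact lt_irrefl _ hn) hm1) (fun n => by split_ifs <;> simp)
    (fun n => by split_ifs <;> first | omega | simp)
    (fun n => by split_ifs <;> first | omega | simp)
  have h1 : ∫⁻ n, ENNReal.ofReal (if n = m then 1 else 0) ∂poissonMeasure r =
      poissonMeasure r {m} := by
    rw [← lintegral_indicator_one .of_discrete]
    refine lintegral_congr fun n => ?_
    by_cases h : n = m <;> simp [h]
  have h2 : poissonMeasure r {m + 1} ≤
      ∫⁻ n, ENNReal.ofReal (if m < n then 1 else 0) ∂poissonMeasure r := by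
    rw [← lintegral_indicator_one .of_discrete]
    refine lintegral_mono fun n => ?_
    by_cases h : n = m + 1 <;> simp [h]
  rw [h1] at h
  have h3 : hNeg σ π ∞ * poissonMeasure r {m + 1} ≤ poissonMeasure r {m} :=
    le_trans (by gcongr) h
  have hm0 := poissonMeasure_singleton_pos hr0 m
  have h4 : hNeg σ π ∞ * r ≤ (m + 1 : ℕ) := by
    rw [← ENNReal.mul_le_mul_iff_left hm0.ne' (measure_ne_top _ _), mul_assoc,
      ← poissonMeasure_singleton_succ, mul_left_comm]
    gcongr
  have := ENNReal.toReal_mono (by simp) h4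
  rw [ENNReal.toReal_mul] at this
  exact_mod_cast this

theorem IsPoissonMeasure.hPos_le (hπ : IsPoissonMeasure σ π) :
    hPos σ π ∞ ≤ 2 / σ Set.univ ^ (1 / 2 : ℝ) := by
  obtain ⟨r, hr⟩ : ∃ r, (σ Set.univ).toNNReal = r := ⟨_, rfl⟩
  have hσ : σ Set.univ = r := by rw [← hr, ENNReal.coe_toNNReal (measure_ne_top _ _)]
  rcases eq_or_ne r 0 with rfl | hr0
  · simp [hσ, ENNReal.div_zero]
  obtain ⟨m, hm1, hm2, -⟩ := exists_poissonMeasure_median hr0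
  have hd2 := sqMoment_pos m hr0
  have hd1 := absMoment_nonneg r m
  have hsq := absMoment_sq_le r m
  have hrle := le_sqMoment_add_absMoment r m
  -- This `u` minimises the right-hand side and gives h⁺ ≤ u(2 - u).
  obtain ⟨htop, h⟩ := hπ.hPos_mul_sqMoment_le hr hr0 hm1 hm2 (absMoment r m / sqMoment r m)
  have ha := ENNReal.toReal_nonneg (a := hPos σ π ∞)
  rw [← ENNReal.ofReal_toReal htop, hσ]
  generalize (hPos σ π ∞).toReal = a at *
  have hrpos : (0 : ℝ) < r := by positivity
  have key : a ≤ 2 / √r := by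
    generalize hu : absMoment r m / sqMoment r m = u at h
    have hu1 : absMoment r m = u * sqMoment r m := by rw [← hu]; field_simp
    rw [hu1] at h hd1 hsq hrle
    generalize sqMoment r m = d at *
    have hu0 : 0 ≤ u := nonneg_of_mul_nonneg_left hd1 hd2
    have h1 : a ≤ u * (2 - u) := by
      refine le_of_mul_le_mul_right ?_ hd2
      linarith
    have h2 : u ^ 2 * d ≤ 1 := by
      refine le_of_mul_le_mul_right ?_ hd2
      linarith
    rcases eq_or_lt_of_le ha with rfl | ha0
    · positivity
    have hu2 : u ≤ 2 := by nlinarith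
    rw [le_div_iff₀ (by positivity)]
    refine abs_le_of_sq_le_sq' ?_ zero_le_two |>.2
    rw [mul_pow, Real.sq_sqrt hrpos.le]
    -- From r ≤ d + ud + 1/4 and u²d ≤ 1. Then (2 - u)(1 + u/2) = 2 - u²/2 ≤ 2 closes the estimate.
    have h3 : u ^ 2 * r ≤ (1 + u / 2) ^ 2 := by nlinarith [sq_nonneg u]
    calc a ^ 2 * r ≤ (u * (2 - u)) ^ 2 * r := by gcongr
      _ = (2 - u) ^ 2 * (u ^ 2 * r) := by ring
      _ ≤ (2 - u) ^ 2 * (1 + u / 2) ^ 2 := by gcongr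
      _ = (2 - u ^ 2 / 2) ^ 2 := by ring
      _ ≤ 2 ^ 2 := by nlinarith [sq_nonneg u]
  refine (ENNReal.ofReal_le_ofReal key).trans (le_of_eq ?_)
  rw [ENNReal.ofReal_div_of_pos (by positivity), Real.sqrt_eq_rpow,
    ← ENNReal.ofReal_rpow_of_pos hrpos]
  simp

theorem IsPoissonMeasure.hNeg_le (hπ : IsPoissonMeasure σ π) :
    hNeg σ π ∞ ≤ 2 / σ Set.univ * (1 + (2 * σ Set.univ) ^ (1 / 2 : ℝ)) := by
  obtain ⟨r, hr⟩ : ∃ r, (σ Set.univ).toNNReal = r := ⟨_, rfl⟩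
  have hσ : σ Set.univ = r := by rw [← hr, ENNReal.coe_toNNReal (measure_ne_top _ _)]
  rcases eq_or_ne r 0 with rfl | hr0
  · simp [hσ, ENNReal.div_zero]
  obtain ⟨m, hm1, hm2, hmr⟩ := exists_poissonMeasure_median hr0
  have hd2 := sqMoment_pos m hr0
  have hsq := absMoment_sq_le r m
  have hrle := le_sqMoment_add_absMoment r m
  obtain ⟨htop, h⟩ := hπ.hNeg_mul_sqMoment_le hr hr0 hm1 hm2
  have h' := hπ.hNeg_mul_le hr hr0 hm1
  have ha := ENNReal.toReal_nonneg (a := hNeg σ π ∞)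
  rw [← ENNReal.ofReal_toReal htop, hσ]
  generalize (hNeg σ π ∞).toReal = a at *
  have hrpos : (0 : ℝ) < r := by positivity
  have key : a ≤ 2 / r * (1 + √(2 * r)) := by
    obtain ⟨v, hv⟩ : ∃ v, √(2 * (r : ℝ)) = v := ⟨_, rfl⟩
    have hv0 : 0 < v := by rw [← hv]; positivity
    have hvr : v ^ 2 = 2 * r := by rw [← hv, Real.sq_sqrt (by positivity)]
    rw [hv, div_mul_eq_mul_div, le_div_iff₀ hrpos]
    -- With v² = 2r: for small v, h⁻r ≤ m + 1 ≤ v² + 1 ≤ 2 + 2v. For large v, a second moment below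
    -- (v/2)² would give v²/2 < v²/4 + v/2 + 1/4, contrary to the case assumption.
    rcases le_total (v ^ 2) (1 + 2 * v) with hle | hle
    · linarith
    · have hd : (v / 2) ^ 2 ≤ sqMoment r m := by
        by_contra! hlt
        have h1 : absMoment r m < v / 2 :=
          (abs_lt_of_sq_lt_sq' (hsq.trans_lt hlt) (by positivity)).2
        linarith
      obtain ⟨ρ, hρ⟩ : ∃ ρ, √(sqMoment r m) = ρ := ⟨_, rfl⟩
      have hρ0 : 0 < ρ := by rw [← hρ]; positivity
      have hρd : sqMoment r m = ρ ^ 2 := by rw [← hρ, Real.sq_sqrt hd2.le]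
      rw [hρd] at h hsq hd
      have h1 : absMoment r m ≤ ρ := (abs_le_of_sq_le_sq' hsq hρ0.le).2
      have h2 : v / 2 ≤ ρ := (abs_le_of_sq_le_sq' hd hρ0.le).2
      -- (2ρ + 1)/ρ² decreases in ρ, so ρ may be lowered to v/2.
      have h3 : a * (v / 2) ^ 2 ≤ 2 * (v / 2) + 1 := by
        refine le_of_mul_le_mul_right ?_ (pow_pos hρ0 2)
        have h4 : a * ρ ^ 2 ≤ 2 * ρ + 1 := by linarith
        calc a * (v / 2) ^ 2 * ρ ^ 2 = a * ρ ^ 2 * (v / 2) ^ 2 := by ring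
          _ ≤ (2 * ρ + 1) * (v / 2) ^ 2 := by gcongr
          _ = 2 * (v / 2) * (v / 2 * ρ) + (v / 2) ^ 2 := by ring
          _ ≤ 2 * (v / 2) * (ρ * ρ) + ρ ^ 2 := by gcongr
          _ = (2 * (v / 2) + 1) * ρ ^ 2 := by ring
      have h5 : a * r = 2 * (a * (v / 2) ^ 2) := by linear_combination (-a / 2) * hvr
      linarith
  refine (ENNReal.ofReal_le_ofReal key).trans (le_of_eq ?_)
  rw [ENNReal.ofReal_mul (by positivity), ENNReal.ofReal_div_of_pos (by positivity),
    ENNReal.ofReal_add zero_le_one (by positivity), Real.sqrt_eq_rpow,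
    ← ENNReal.ofReal_rpow_of_pos (by positivity), ENNReal.ofReal_mul zero_le_two]
  simp

end Bounds

end PoissonSpace

end

theorem mainTheorem8 {X : Type*} [MetricSpace X] [MeasurableSpace X] [BorelSpace X]
    (σ : Measure X) [IsFiniteMeasure σ] [NullSingletonClass σ]
    (π : Measure (PoissonSpace.Configuration X)) (hπ : PoissonSpace.IsPoissonMeasure σ π) :
    (PoissonSpace.kPos σ π ∞ = PoissonSpace.hPos σ π ∞ ∧
      PoissonSpace.hPos σ π ∞ ≤ 2 * PoissonSpace.poincareConst σ π ∞ ^ (1 / 2 : ℝ) ∧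
      2 * PoissonSpace.poincareConst σ π ∞ ^ (1 / 2 : ℝ) = 2 / σ Set.univ ^ (1 / 2 : ℝ)) ∧
    (PoissonSpace.kNeg σ π ∞ = PoissonSpace.hNeg σ π ∞ ∧
      PoissonSpace.hNeg σ π ∞ ≤
        2 / σ Set.univ * (1 + (2 * σ Set.univ) ^ (1 / 2 : ℝ))) := by
  have := hπ.isProbabilityMeasure
  refine ⟨⟨PoissonSpace.kPos_eq_hPos, ?_, ?_⟩, PoissonSpace.kNeg_eq_hNeg, hπ.hNeg_le⟩
  · rw [hπ.poincareConst_eq, ENNReal.inv_rpow, ← div_eq_mul_inv]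
    exact hπ.hPos_le
  · rw [hπ.poincareConst_eq, ENNReal.inv_rpow, ← div_eq_mul_inv]
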